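/- A \emph{Cartesian category} is a category with a chosen terminal object $1$ and chosen binary products, and $\mathbf{cartCat}$ is the category whose objects are Cartesian categories and whose arrows are the functors preserving the chosen terminal object, products and projections exactly. Composition is written in diagrammatic order. For a commutative monoid $(B,+_B,0_B)$ in a Cartesian category and maps $f,g:T\to B$, write $f+g:=\langle f,g\rangle +_B$ and $0:=\,!\,0_B$; this makes the maps $T\to B$ a commutative monoid. \textbf{Proposition.} There is an endofunctor $\mathbf{Fa\grave{a}}$ of $\mathbf{cartCat}$ such that, for every Cartesian category $\mathbb X$, the Cartesian category $\mathbf{Fa\grave{a}}(\mathbb X)$ is given as follows. \begin{itemize} \item Its objects are the pairs $((A,+_A,0_A),X)$ with $(A,+_A,0_A)$ a commutative monoid in $\mathbb X$ and $X$ an object of $\mathbb X$. \item A morphism $((A,+_A,0_A),X)\to((B,+_B,0_B),Y)$ is an infinite sequence $(f_*,f_1,f_2,\dots)$, where $f_*:X\to Y$ is any map of $\mathbb X$ and, for each $n\ge 1$, $f_n:A^n\times X\to B$ is a map of $\mathbb X$ which is symmetric in its first $n$ variables and additive (preserves $+$ and $0$) in each of them. Here $A^n\times X=A\times(A\times\cdots\times(A\times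 X))$, with projections $\pi_0,\dots,\pi_{n-1}$ to $A$ and $\pi_n$ to $X$. \item The identity is $(1_X,\pi_0,0,0,\dots)$. The composite of $(f_*,f_1,\dots):((A,+_A,0_A),X)\to((B,+_B,0_B),Y)$ and $(g_*,g_1,\dots):((B,+_B,0_B),Y)\to((C,+_C,0_C),Z)$ is given by $(fg)_*=f_*g_*$ and the Fa\`a di Bruno formula \[ (fg)_n=\sum_{\{\beta_1,\dots,\beta_k\}}\bigl\langle p_{\beta_1}f_{|\beta_1|},\dots,p_{\beta_k}f_{|\beta_k|},\pi_n f_*\bigr\rangle g_k , \] the sum being over all partitions of $\{0,\dots,n-1\}$ into nonempty blocks, where $p_\beta=\langle\pi_{j_1},\dots,\pi_{j_m},\pi_n\rangle$ for $\beta=\{j_1<\dots<j_m\}$. \item The terminal object is $(1,1)$, the first component carrying its unique monoid structure. The product of $((A,+_A,0_A),X)$ and $((B,+_B,0_B),Y)$ is \[ \bigl((A\times B,\ \mathrm{ex}(+_A\times +_B),\ 0_A\times 0_B),\ X\times Y\bigr), \] where $\mathrm{ex}:(A\times B)\times(A\times B)\to(A\times A)\times(B\times B)$ interchanges the two interior terms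 and $0_A\times 0_B$ is regarded as the map $\langle 0_A,0_B\rangle:1\to A\times B$. Its projections are $(\pi_X,\pi_0\pi_A,0,0,\dots)$ and $(\pi_Y,\pi_0\pi_B,0,0,\dots)$, where $\pi_X,\pi_Y$ are the projections of $X\times Y$ and $\pi_A,\pi_B$ those of $A\times B$. \end{itemize} For an arrow $F:\mathbb X\to\mathbb Y$ of $\mathbf{cartCat}$, the arrow $\mathbf{Fa\grave{a}}(F)$ of $\mathbf{cartCat}$ acts by \[ ((A,+_A,0_A),X)\mapsto((FA,F(+_A),F(0_A)),FX),\qquad (f_*,f_1,f_2,\dots)\mapsto(F(f_*),F(f_1),F(f_2),\dots). \] -/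

import Mathlib

open CategoryTheory MonoidalCategory CartesianMonoidalCategory
open scoped AddMonObj MonObj

universe v u v₁ u₁ v₂ u₂

/-! ### Cartesian categories and strict functors -/

set_option linter.checkUnivs false in
/-- A Cartesian category: a category with a chosen terminal object `𝟙_` and chosen binary
products `A ⊗ B`. -/
structure CartCat where
  carrier : Type u
  [category : Category.{v} carrier]
  [cartesian : CartesianMonoidalCategory carrier]

namespace CartCat

attribute [instance] category cartesian

instance : CoeSort CartCat.{v, u} (Type u) := ⟨carrier⟩

/-- The symmetry of a Cartesian category is the exchange map `⟨π₁, π₀⟩`. -/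
instance braided (X : CartCat.{v, u}) : BraidedCategory X :=
  BraidedCategory.ofCartesianMonoidalCategory

end CartCat

/-- A functor that preserves the chosen products exactly: the chosen terminal object, the chosen
binary products, and their projections. Equality of morphisms whose (co)domains are equal only
propositionally is expressed as equality in the type of all arrows of the target category. -/
structure StrictCartFunctor (C : Type u₁) [Category.{v₁} C] [CartesianMonoidalCategory C]
    (D : Type u₂) [Category.{v₂} D] [CartesianMonoidalCategory D] extends C ⥤ D where
  obj_unit : obj (𝟙_ C) = 𝟙_ D
  obj_prod (A B : C) : obj (A ⊗ B) = obj A ⊗ obj B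
  map_fst (A B : C) : Arrow.mk (map (fst A B)) = Arrow.mk (fst (obj A) (obj B))
  map_snd (A B : C) : Arrow.mk (map (snd A B)) = Arrow.mk (snd (obj A) (obj B))

namespace CartCat

/-- The category of Cartesian categories and functors preserving the chosen products exactly. -/
instance : Category CartCat.{v, u} where
  Hom X Y := StrictCartFunctor X Y
  id X :=
    { toFunctor := 𝟭 X
      obj_unit := rfl
      obj_prod := fun _ _ => rfl
      map_fst := fun _ _ => rfl
      map_snd := fun _ _ => rfl }
  comp F G :=
    { toFunctor := F.toFunctor ⋙ G.toFunctor
      obj_unit := (congrArg G.obj F.obj_unit).trans G.obj_unit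
      obj_prod := fun A B => (congrArg G.obj (F.obj_prod A B)).trans (G.obj_prod _ _)
      map_fst := fun A B =>
        (congrArg G.toFunctor.mapArrow.obj (F.map_fst A B)).trans (G.map_fst _ _)
      map_snd := fun A B =>
        (congrArg G.toFunctor.mapArrow.obj (F.map_snd A B)).trans (G.map_snd _ _) }
  id_comp _ := rfl
  comp_id _ := rfl
  assoc _ _ _ := rfl

end CartCat

namespace Faa

section Powers

variable {C : Type u} [Category.{v} C] [CartesianMonoidalCategory C]

/-- The product `A × (A × ⋯ × (A × X))` with `n` factors `A`, written `Aⁿ × X`. -/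
def pow (A X : C) : ℕ → C
  | 0 => X
  | n + 1 => A ⊗ pow A X n

/-- The projections `π₀, …, πₙ₋₁ : Aⁿ × X ⟶ A`. -/
def proj (A X : C) : (n : ℕ) → Fin n → (pow A X n ⟶ A)
  | 0 => Fin.elim0
  | n + 1 => Fin.cons (fst A (pow A X n)) (fun i => snd A (pow A X n) ≫ proj A X n i)

/-- The last projection `πₙ : Aⁿ × X ⟶ X`. -/
def last (A X : C) : (n : ℕ) → (pow A X n ⟶ X)
  | 0 => 𝟙 X
  | n + 1 => snd A (pow A X n) ≫ last A X n

/-- The tuple `⟨a₀, …, aₙ₋₁, x⟩ : T ⟶ Aⁿ × X`. -/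
def tuple {A X T : C} : (n : ℕ) → (Fin n → (T ⟶ A)) → (T ⟶ X) → (T ⟶ pow A X n)
  | 0, _, x => x
  | n + 1, a, x => lift (a 0) (tuple n (fun i => a i.succ) x)

end Powers

variable (C : Type u) [Category.{v} C] [CartesianMonoidalCategory C] [BraidedCategory C]

/-- Pairs `((A, +, 0), X)` of a commutative monoid `(A, +, 0)` in `C` and an object `X` of `C`. -/
structure Obj where
  vec : C
  base : C
  [monoid : AddMonObj vec]
  [comm : IsCommAddMonObj vec]

attribute [instance] Obj.monoid Obj.comm

variable {C}

/-- `f : Aⁿ × X ⟶ B` is additive in each of the first `n` variables. As usual, for maps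
`g, h : T ⟶ B` into a monoid, `g + h` is `⟨g, h⟩ ≫ +_B` and `0` is `! ≫ 0_B`. -/
def IsMultiadditive {A X B : C} [AddMonObj A] [AddMonObj B] {n : ℕ} (f : pow A X n ⟶ B) : Prop :=
  ∀ (T : C) (a : Fin n → (T ⟶ A)) (x : T ⟶ X) (i : Fin n),
    (∀ b c : T ⟶ A, tuple n (Function.update a i (b + c)) x ≫ f =
      tuple n (Function.update a i b) x ≫ f + tuple n (Function.update a i c) x ≫ f) ∧
    tuple n (Function.update a i 0) x ≫ f = 0

/-- `f : Aⁿ × X ⟶ B` is symmetric in the first `n` variables. -/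
def IsSymmetric {A X B : C} {n : ℕ} (f : pow A X n ⟶ B) : Prop :=
  ∀ (T : C) (a : Fin n → (T ⟶ A)) (x : T ⟶ X) (s : Equiv.Perm (Fin n)),
    tuple n (fun i => a (s i)) x ≫ f = tuple n a x ≫ f

/-- Sequences `(f_*, f₁, f₂, …)`, where `f_* : X ⟶ Y` is any map and each `fₙ : Aⁿ × X ⟶ B`
is additive and symmetric in its first `n` variables. -/
structure Hom (P Q : Obj C) where
  star : P.base ⟶ Q.base
  map (n : ℕ+) : pow P.vec P.base n ⟶ Q.vec
  additive (n : ℕ+) : IsMultiadditive (map n)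
  symmetric (n : ℕ+) : IsSymmetric (map n)

/-- The components `(π₀ ≫ k, 0, 0, …)` in degrees `1, 2, 3, …`, for `k : A ⟶ B`. -/
def linear (P Q : Obj C) (k : P.vec ⟶ Q.vec) (n : ℕ+) : pow P.vec P.base n ⟶ Q.vec :=
  if n = 1 then proj P.vec P.base n ⟨0, n.pos⟩ ≫ k else 0

/-- The summand of the Faà di Bruno formula attached to a partition `c` of the `n` additive
variables into nonempty blocks `β₁, …, β_k` (equivalently, a symmetric tree of height two and
width `n`): `⟨f_{|β₁|}(π_{β₁}, πₙ), …, f_{|β_k|}(π_{β_k}, πₙ), πₙ f_*⟩ g_k`. -/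
def compTerm {P Q R : Obj C} (f : Hom P Q) (g : Hom Q R) (n : ℕ+) (c : OrderedFinpartition n) :
    pow P.vec P.base n ⟶ R.vec :=
  tuple c.length
      (fun m => tuple (c.partSize m) (fun j => proj P.vec P.base n (c.emb m j))
        (last P.vec P.base n) ≫ f.map ⟨c.partSize m, c.partSize_pos m⟩)
      (last P.vec P.base n ≫ f.star) ≫
    g.map ⟨c.length, c.length_pos n.pos⟩

/-- The pair `(1, 1)`, with the unique monoid structure on the terminal object. -/
def unit : Obj C where
  vec := 𝟙_ C
  base := 𝟙_ C

/-- The pair `((A × B, ex(+_A × +_B), 0_A × 0_B), X × Y)`. -/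
def prod (P Q : Obj C) : Obj C where
  vec := P.vec ⊗ Q.vec
  base := P.base ⊗ Q.base

theorem prod_add (P Q : Obj C) : σ[(prod P Q).vec] =
    lift (lift (fst _ _ ≫ fst _ _) (snd _ _ ≫ fst _ _) ≫ σ[P.vec])
      (lift (fst _ _ ≫ snd _ _) (snd _ _ ≫ snd _ _) ≫ σ[Q.vec]) := by
  change tensorμ P.vec Q.vec P.vec Q.vec ≫ (σ[P.vec] ⊗ₘ σ[Q.vec]) = _
  ext <;> simp

theorem prod_zero (P Q : Obj C) : ζ[(prod P Q).vec] = lift ζ[P.vec] ζ[Q.vec] := by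
  change (λ_ (𝟙_ C)).inv ≫ (ζ[P.vec] ⊗ₘ ζ[Q.vec]) = _
  ext <;> simp

variable (C) in
/-- The assertion that the above objects and morphisms form a Cartesian category, with
composition given by the Faà di Bruno formula and with the prescribed identities, terminal
object, products and projections. All of the operations are determined by the equations. -/
structure CartesianStructure where
  id (P : Obj C) : Hom P P
  comp {P Q R : Obj C} (f : Hom P Q) (g : Hom Q R) : Hom P R
  id_star (P : Obj C) : (id P).star = 𝟙 P.base
  id_map (P : Obj C) (n : ℕ+) : (id P).map n = linear P P (𝟙 P.vec) n
  comp_star {P Q R : Obj C} (f : Hom P Q) (g : Hom Q R) : (comp f g).star = f.star ≫ g.star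
  comp_map {P Q R : Obj C} (f : Hom P Q) (g : Hom Q R) (n : ℕ+) :
    (comp f g).map n = ∑ c : OrderedFinpartition n, compTerm f g n c
  id_comp {P Q : Obj C} (f : Hom P Q) : comp (id P) f = f
  comp_id {P Q : Obj C} (f : Hom P Q) : comp f (id Q) = f
  assoc {P Q R S : Obj C} (f : Hom P Q) (g : Hom Q R) (h : Hom R S) :
    comp (comp f g) h = comp f (comp g h)
  toUnit (P : Obj C) : Hom P unit
  toUnit_unique {P : Obj C} (f : Hom P unit) : f = toUnit P
  fst (P Q : Obj C) : Hom (prod P Q) P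
  fst_star (P Q : Obj C) : (fst P Q).star = CartesianMonoidalCategory.fst P.base Q.base
  fst_map (P Q : Obj C) (n : ℕ+) :
    (fst P Q).map n = linear (prod P Q) P (CartesianMonoidalCategory.fst P.vec Q.vec) n
  snd (P Q : Obj C) : Hom (prod P Q) Q
  snd_star (P Q : Obj C) : (snd P Q).star = CartesianMonoidalCategory.snd P.base Q.base
  snd_map (P Q : Obj C) (n : ℕ+) :
    (snd P Q).map n = linear (prod P Q) Q (CartesianMonoidalCategory.snd P.vec Q.vec) n
  lift {T P Q : Obj C} (f : Hom T P) (g : Hom T Q) : Hom T (prod P Q)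
  lift_fst {T P Q : Obj C} (f : Hom T P) (g : Hom T Q) : comp (lift f g) (fst P Q) = f
  lift_snd {T P Q : Obj C} (f : Hom T P) (g : Hom T Q) : comp (lift f g) (snd P Q) = g
  lift_unique {T P Q : Obj C} (f : Hom T P) (g : Hom T Q) (h : Hom T (prod P Q)) :
    comp h (fst P Q) = f → comp h (snd P Q) = g → h = lift f g

namespace CartesianStructure

/-- The category on `Obj C` whose morphisms are the sequences `Hom P Q`. -/
abbrev category (S : CartesianStructure C) : Category.{v} (Obj C) where
  Hom := Hom
  id := S.id
  comp := S.comp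
  id_comp := S.id_comp
  comp_id := S.comp_id
  assoc := S.assoc

/-- The chosen finite products `unit` and `prod P Q`, with projections `S.fst` and `S.snd`. -/
abbrev cartesian (S : CartesianStructure C) :
    letI := S.category
    CartesianMonoidalCategory (Obj C) :=
  letI := S.category
  .ofChosenFiniteProducts
    ⟨Limits.asEmptyCone unit,
      Limits.IsTerminal.ofUniqueHom (C := Obj C) S.toUnit (fun _ f => S.toUnit_unique f)⟩
    (fun P Q => ⟨Limits.BinaryFan.mk (C := Obj C) (P := prod P Q) (S.fst P Q) (S.snd P Q),
      Limits.BinaryFan.IsLimit.mk _ (fun f g => S.lift f g) (fun f g => S.lift_fst f g)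
        (fun f g => S.lift_snd f g) (fun f g h => S.lift_unique f g h)⟩)

/-- The resulting Cartesian category. -/
def toCartCat (S : CartesianStructure C) : CartCat.{v, max u v} :=
  letI := S.category
  letI := S.cartesian
  ⟨Obj C⟩

end CartesianStructure

/-- The operations `G` on objects and on morphisms are given by
`((A, +, 0), X) ↦ ((F A, F +, F 0), F X)` and `(f_*, f₁, f₂, …) ↦ (F f_*, F f₁, F f₂, …)`. -/
structure IsAction {D : Type u₁} [Category.{v₁} D] [CartesianMonoidalCategory D]
    [BraidedCategory D] (F : C ⥤ D) (obj : Obj C → Obj D)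
    (map : ∀ P Q : Obj C, Hom P Q → Hom (obj P) (obj Q)) : Prop where
  vec (P : Obj C) : (obj P).vec = F.obj P.vec
  add (P : Obj C) : Arrow.mk σ[(obj P).vec] = Arrow.mk (F.map σ[P.vec])
  zero (P : Obj C) : Arrow.mk ζ[(obj P).vec] = Arrow.mk (F.map ζ[P.vec])
  base (P : Obj C) : (obj P).base = F.obj P.base
  map_star (P Q : Obj C) (f : Hom P Q) :
    Arrow.mk (map P Q f).star = Arrow.mk (F.map f.star)
  map_map (P Q : Obj C) (f : Hom P Q) (n : ℕ+) :
    Arrow.mk ((map P Q f).map n) = Arrow.mk (F.map (f.map n))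

end Faa

/-! By Yoneda and symmetry, the components `f₁, f₂, …` of an arrow amount to one function of finite
multisets of generalized elements `T ⟶ A` for each `x : T ⟶ X`, additive in each element and set to
`0` on the empty multiset (`Hom.eval`, `Hom.ext_eval`). The Faà di Bruno formula then becomes an
operation `diBruno` on functions of multisets, and the category axioms become statements about
partitions.

A partition is encoded as a monomial whose variables are its blocks, so the sum of all partitions of
`s` is a polynomial `parts s`. Inserting a letter `a` either creates the block `{a}` or enlarges one
block: it is multiplication by `X {a}` plus a derivation. Associativity rests on
`linearize_parts_parts`: partitioning the blocks of a partition is the same as refining the blocks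
of a coarser one. Both sides satisfy the same insertion recursion, and additivity of the outermost
function turns this identity into `diBruno_assoc`. Composing with a linear arrow keeps only the
one-block partition (`diBruno_right`) or only the partition into singletons (`diBruno_left`); this
gives the unit laws, and it makes composition with a projection act component by component, so
products are inherited from the base category.

A strict functor has identities, up to transport along object equalities, as product comparison
maps. It is therefore braided monoidal and carries commutative monoids, multiadditivity, symmetry,
sums and tuples along. Functoriality is an equality of arrows, where these transports disappear. -/

namespace Faa

noncomputable section

open MvPolynomial

/-! ### Linear maps on polynomials determined by monomials -/

section Linearize

variable {V N : Type*} [AddCommMonoid N]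

/-- The monomial in the commuting variables `X i` with `i` ranging over a multiset. -/
def monom (s : Multiset V) : MvPolynomial V ℕ := (s.map X).prod

@[simp]
theorem monom_zero : monom (0 : Multiset V) = 1 := by simp [monom]

@[simp]
theorem monom_cons (i : V) (s : Multiset V) : monom (i ::ₘ s) = X i * monom s := by simp [monom]

@[simp]
theorem monom_singleton (i : V) : monom ({i} : Multiset V) = X i := by simp [monom]

theorem monom_toMultiset (m : V →₀ ℕ) :
    monom (Finsupp.toMultiset m) = monomial m 1 := by
  classical
  induction m using Finsupp.induction_linear with
  | zero => simp
  | add m m' hm hm' =>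
    rw [map_add, monom, Multiset.map_add, Multiset.prod_add, ← monom, ← monom, hm, hm',
      monomial_mul, one_mul]
  | single i n =>
    rw [Finsupp.toMultiset_single, monom, Multiset.map_nsmul, Multiset.prod_nsmul,
      Multiset.map_singleton, Multiset.prod_singleton, X_pow_eq_monomial]

theorem lin_ext {L L' : MvPolynomial V ℕ →ₗ[ℕ] N} (h : ∀ s, L (monom s) = L' (monom s)) :
    L = L' :=
  (basisMonomials V ℕ).ext fun m => by simpa [← monom_toMultiset] using h (Finsupp.toMultiset m)

/-- The linear map on polynomials whose values on monomials are prescribed. -/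
def linearize (h : Multiset V → N) : MvPolynomial V ℕ →ₗ[ℕ] N :=
  (basisMonomials V ℕ).constr ℕ fun m => h (Finsupp.toMultiset m)

@[simp]
theorem linearize_monom (h : Multiset V → N) (s : Multiset V) : linearize h (monom s) = h s := by
  classical
  obtain ⟨m, rfl⟩ : ∃ m : V →₀ ℕ, Finsupp.toMultiset m = s :=
    ⟨Multiset.toFinsupp s, Multiset.toFinsupp_toMultiset s⟩
  rw [monom_toMultiset]
  exact (basisMonomials V ℕ).constr_basis ℕ (fun m => h (Finsupp.toMultiset m)) m

end Linearize

/-! ### Generating polynomials of partitions and refinement -/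

section Parts

variable {α β : Type*}

/-- The derivation that adjoins the letter `a` to one of the blocks. -/
def adjoin (a : α) : Derivation ℕ (MvPolynomial (Multiset α) ℕ) (MvPolynomial (Multiset α) ℕ) :=
  mkDerivation ℕ fun b => X (a ::ₘ b)

@[simp]
theorem adjoin_X (a : α) (b : Multiset α) : adjoin a (X b) = X (a ::ₘ b) :=
  mkDerivation_X _ _ _

theorem adjoin_comm (a b : α) (p : MvPolynomial (Multiset α) ℕ) :
    adjoin a (adjoin b p) = adjoin b (adjoin a p) := by
  induction p using MvPolynomial.induction_on with
  | C n => simp [adjoin]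
  | add p q hp hq => simp [hp, hq]
  | mul_X p i hp =>
    simp only [Derivation.leibniz, smul_eq_mul, map_add, adjoin_X, hp, Multiset.cons_swap a b]
    ring

/-- Insertion of the letter `a` into a partition, as a new block or in an old one. -/
def ins (a : α) : MvPolynomial (Multiset α) ℕ →ₗ[ℕ] MvPolynomial (Multiset α) ℕ :=
  LinearMap.mulLeft ℕ (X {a}) + (adjoin a).toLinearMap

theorem ins_apply (a : α) (p : MvPolynomial (Multiset α) ℕ) :
    ins a p = X {a} * p + adjoin a p := rfl

/-- This is what allows folding over an unordered multiset. The derivations commute, and the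
remaining cross term is the block `{a, b}`, which is symmetric. -/
instance ins_leftCommutative :
    LeftCommutative fun (a : α) (p : MvPolynomial (Multiset α) ℕ) => ins a p where
  left_comm a b p := by
    simp only [ins_apply, map_add, Derivation.leibniz, smul_eq_mul, adjoin_X, adjoin_comm a b p]
    rw [show a ::ₘ ({b} : Multiset α) = b ::ₘ {a} from Multiset.cons_swap a b 0]
    ring

/-- The sum of all partitions of a multiset into blocks, each partition being the product of its
blocks. -/
def parts (s : Multiset α) : MvPolynomial (Multiset α) ℕ :=
  s.foldr (fun a p => ins a p) 1

@[simp]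
theorem parts_zero : parts (0 : Multiset α) = 1 := Multiset.foldr_zero _ _

@[simp]
theorem parts_cons (a : α) (s : Multiset α) : parts (a ::ₘ s) = ins a (parts s) :=
  Multiset.foldr_cons _ _ _ _

theorem rename_adjoin (f : α → β) (a : α) (p : MvPolynomial (Multiset α) ℕ) :
    rename (Multiset.map f) (adjoin a p) = adjoin (f a) (rename (Multiset.map f) p) := by
  induction p using MvPolynomial.induction_on with
  | C n => simp [adjoin]
  | add p q hp hq => simp [hp, hq]
  | mul_X p i hp => simp [hp]

theorem parts_map (f : α → β) (s : Multiset α) :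
    parts (s.map f) = rename (Multiset.map f) (parts s) := by
  induction s using Multiset.induction with
  | empty => simp
  | cons a s ih => simp [ih, ins_apply, rename_adjoin]

/-- Products of blocks, seen as a single block of blocks. -/
def asBlock : MvPolynomial (Multiset α) ℕ →ₗ[ℕ] MvPolynomial (Multiset (Multiset α)) ℕ :=
  linearize X

/-- The polynomial `asBlock p` is linear in the outer variables, so differentiating it only adds one
inner block to each of its terms. -/
theorem adjoin_asBlock (b : Multiset α) (p : MvPolynomial (Multiset α) ℕ) :
    adjoin b (asBlock p) = asBlock (X b * p) := by
  have : (adjoin b).toLinearMap ∘ₗ asBlock = asBlock ∘ₗ LinearMap.mulLeft ℕ (X b) :=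
    lin_ext fun s => by simp [asBlock, ← monom_cons]
  exact LinearMap.congr_fun this p

/-- The derivation that inserts `a` into one of the blocks of blocks. -/
def adjoin₂ (a : α) : Derivation ℕ (MvPolynomial (Multiset (Multiset α)) ℕ)
    (MvPolynomial (Multiset (Multiset α)) ℕ) :=
  mkDerivation ℕ fun r => asBlock (ins a (monom r))

theorem adjoin₂_asBlock (a : α) (p : MvPolynomial (Multiset α) ℕ) :
    adjoin₂ a (asBlock p) = asBlock (ins a p) := by
  have : (adjoin₂ a).toLinearMap ∘ₗ asBlock = asBlock ∘ₗ ins a :=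
    lin_ext fun s => by simp [asBlock, adjoin₂]
  exact LinearMap.congr_fun this p

@[simp]
theorem asBlock_monom (s : Multiset (Multiset α)) : asBlock (monom s) = X s :=
  linearize_monom _ _

theorem adjoin₂_X (a : α) (r : Multiset (Multiset α)) :
    adjoin₂ a (X r) = X ({a} ::ₘ r) + asBlock (adjoin a (monom r)) := by
  rw [← asBlock_monom, adjoin₂_asBlock, ins_apply, map_add, ← monom_cons, asBlock_monom]

/-- The commutator of the two derivations is `adjoin (a ::ₘ b)`: the extra term arises when `a`
enters the block `b` that has just been adjoined. Leibniz reduces the check to variables. -/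
theorem adjoin₂_adjoin (a : α) (b : Multiset α)
    (p : MvPolynomial (Multiset (Multiset α)) ℕ) :
    adjoin₂ a (adjoin b p) = adjoin b (adjoin₂ a p) + adjoin (a ::ₘ b) p := by
  induction p using MvPolynomial.induction_on with
  | C n => simp [adjoin, adjoin₂]
  | add p q hp hq => simp only [map_add, hp, hq]; ring
  | mul_X p i hp =>
    have : adjoin₂ a (adjoin b (X i)) = adjoin b (adjoin₂ a (X i)) + adjoin (a ::ₘ b) (X i) := by
      simp only [adjoin_X, adjoin₂_X, map_add, adjoin_asBlock, monom_cons, Derivation.leibniz,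
        smul_eq_mul, Multiset.cons_swap b {a}]
      rw [mul_comm (monom i), ← monom_cons, asBlock_monom]
      ring
    simp only [Derivation.leibniz, smul_eq_mul, map_add, hp, this]
    ring

/-- Insertion of the letter `a` into a partition of blocks of blocks. -/
def ins₂ (a : α) : MvPolynomial (Multiset (Multiset α)) ℕ →ₗ[ℕ]
    MvPolynomial (Multiset (Multiset α)) ℕ :=
  LinearMap.mulLeft ℕ (X {{a}}) + (adjoin₂ a).toLinearMap

theorem ins₂_apply (a : α) (p : MvPolynomial (Multiset (Multiset α)) ℕ) :
    ins₂ a p = X {{a}} * p + adjoin₂ a p := rfl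

/-- After `b` has been inserted, the letter `a` goes either elsewhere or into `b` itself. This is
the inductive step for comparing the two levels of insertion. -/
theorem ins₂_ins (a : α) (b : Multiset α) (p : MvPolynomial (Multiset (Multiset α)) ℕ) :
    ins₂ a (ins b p) = ins b (ins₂ a p) + ins (a ::ₘ b) p := by
  simp only [ins_apply, ins₂_apply, map_add, Derivation.leibniz, smul_eq_mul, adjoin_X,
    adjoin₂_adjoin, adjoin₂_X, monom_singleton]
  rw [← monom_singleton (a ::ₘ b), asBlock_monom,
    show b ::ₘ ({{a}} : Multiset (Multiset α)) = {a} ::ₘ {b} from Multiset.cons_swap _ _ 0]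
  ring

/-- On monomials, peel off one block `b`: `ins a (X b * p) = X b * ins a p + X (a ::ₘ b) * p`
matches the commutation rule `ins₂_ins`. -/
theorem linearize_parts_ins (a : α) (p : MvPolynomial (Multiset α) ℕ) :
    linearize parts (ins a p) = ins₂ a (linearize parts p) := by
  have mulX (b : Multiset α) (p : MvPolynomial (Multiset α) ℕ) :
      linearize parts (X b * p) = ins b (linearize parts p) := by
    have : linearize parts ∘ₗ LinearMap.mulLeft ℕ (X b) = ins b ∘ₗ linearize parts :=
      lin_ext fun s => by simp [← monom_cons]
    exact LinearMap.congr_fun this p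
  have : linearize parts ∘ₗ ins a = ins₂ a ∘ₗ linearize parts := by
    refine lin_ext fun s => ?_
    simp only [LinearMap.comp_apply, linearize_monom]
    induction s using Multiset.induction with
    | empty =>
      rw [monom_zero, parts_zero, ins_apply, ins₂_apply, map_add, mulX]
      rw [← monom_zero, linearize_monom]
      simp [ins_apply]
    | cons b s ih =>
      rw [parts_cons, ins₂_ins, ← ih, ← mulX, monom_cons, ← linearize_monom parts s, ← mulX,
        ← map_add]
      congr 1
      simp only [ins_apply, Derivation.leibniz, adjoin_X, smul_eq_mul]
      ring
  exact LinearMap.congr_fun this p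

/-- Replace each block by the sum of its partitions. -/
def refineBlocks : MvPolynomial (Multiset α) ℕ →ₐ[ℕ] MvPolynomial (Multiset (Multiset α)) ℕ :=
  aeval fun b => asBlock (parts b)

/-- An algebra map intertwines two derivations as soon as it does so on variables, and there the
claim is the recursion `parts (a ::ₘ b) = ins a (parts b)`. -/
theorem refineBlocks_ins (a : α) (p : MvPolynomial (Multiset α) ℕ) :
    refineBlocks (ins a p) = ins₂ a (refineBlocks p) := by
  have key : refineBlocks (adjoin a p) = adjoin₂ a (refineBlocks p) := by
    induction p using MvPolynomial.induction_on with
    | C n => simp [adjoin, adjoin₂, refineBlocks]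
    | add p q hp hq => simp only [map_add, hp, hq]
    | mul_X p i hp =>
      have : refineBlocks (X (a ::ₘ i)) = adjoin₂ a (refineBlocks (X i)) := by
        simp [refineBlocks, adjoin₂_asBlock]
      simp only [Derivation.leibniz, smul_eq_mul, map_add, map_mul, adjoin_X, hp, this]
  rw [ins_apply, map_add, map_mul, key, ins₂_apply]
  congr 2
  rw [refineBlocks, aeval_X, ← monom_singleton, monom_singleton, ← Multiset.cons_zero, parts_cons,
    parts_zero, ins_apply]
  simp [← monom_singleton]

/-- Partitions of the set of blocks of a partition are the same as partitions of the blocks of a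
coarser partition. -/
theorem linearize_parts_parts (s : Multiset α) :
    linearize parts (parts s) = refineBlocks (parts s) := by
  induction s using Multiset.induction with
  | empty =>
    rw [parts_zero, map_one refineBlocks, ← monom_zero, linearize_monom, parts_zero]
  | cons a s ih => rw [parts_cons, linearize_parts_ins, ih, refineBlocks_ins]

end Parts

end

end Faa

namespace Faa

noncomputable section

open MvPolynomial

/-! ### Faà di Bruno composition of functions of multisets -/

section Compose

variable {A B C D : Type*}

/-- A function of finite multisets, additive in each element. -/
structure IsAdditive [AddCommMonoid B] [AddCommMonoid C] (g : Multiset B → C) : Prop where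
  add (b c : B) (s : Multiset B) : g ((b + c) ::ₘ s) = g (b ::ₘ s) + g (c ::ₘ s)
  zero (s : Multiset B) : g (0 ::ₘ s) = 0

/-- The Faà di Bruno composite of two functions of finite multisets. -/
def diBruno [AddCommMonoid C] (f : Multiset A → B) (g : Multiset B → C) (s : Multiset A) : C :=
  linearize (fun r => g (r.map f)) (parts s)

theorem linearize_rename [AddCommMonoid C] (f : A → B) (g : Multiset B → C)
    (p : MvPolynomial A ℕ) :
    linearize g (rename f p) = linearize (fun s => g (s.map f)) p := by
  have : linearize g ∘ₗ (rename f).toLinearMap = linearize (fun s => g (s.map f)) := by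
    refine lin_ext fun s => ?_
    have : rename f (monom s) = monom (s.map f) := by
      simp [monom, map_multiset_prod]
    simp [this]
  exact LinearMap.congr_fun this p

theorem linearize_asBlock_mul [AddCommMonoid C] [AddCommMonoid D] {h : Multiset C → D}
    (hh : IsAdditive h) (k : Multiset (Multiset A) → C) (p : MvPolynomial (Multiset A) ℕ)
    (t : Multiset (Multiset (Multiset A))) :
    linearize (fun r => h (r.map k)) (asBlock p * monom t) = h (linearize k p ::ₘ t.map k) := by
  let L : C →+ D := ⟨⟨fun c => h (c ::ₘ t.map k), hh.zero _⟩, fun b c => hh.add b c _⟩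
  have : linearize (fun r => h (r.map k)) ∘ₗ LinearMap.mulRight ℕ (monom t) ∘ₗ asBlock =
      L.toNatLinearMap ∘ₗ linearize k :=
    lin_ext fun s => by simp [← monom_cons, L]
  exact LinearMap.congr_fun this p

/-- Refining each block independently produces a product of sums; multiadditivity of `h` moves each
sum inside the corresponding argument. -/
theorem linearize_refineBlocks [AddCommMonoid C] [AddCommMonoid D] {h : Multiset C → D}
    (hh : IsAdditive h) (k : Multiset (Multiset A) → C) (p : MvPolynomial (Multiset A) ℕ) :
    linearize (fun r => h (r.map k)) (refineBlocks p) =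
      linearize (fun s => h (s.map fun b => linearize k (parts b))) p := by
  -- The factor `t` keeps room for other arguments while blocks of `s` are absorbed one at a time
  -- into a new function `h'`, so the induction needs `h` to vary.
  have key (s t) : linearize (fun r => h (r.map k)) (refineBlocks (monom s) * monom t) =
      h (s.map (fun b => linearize k (parts b)) + t.map k) := by
    induction s using Multiset.induction generalizing h with
    | empty => simp
    | cons b s ih =>
      let h' : Multiset C → D := fun u => h (linearize k (parts b) ::ₘ u)
      have hh' : IsAdditive h' :=
        ⟨fun a c u => by simp only [h', Multiset.cons_swap _ _ u, hh.add],
          fun u => by simp only [h', Multiset.cons_swap _ _ u, hh.zero]⟩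
      have : linearize (fun r => h (r.map k)) ∘ₗ LinearMap.mulLeft ℕ (asBlock (parts b)) =
          linearize (fun r => h' (r.map k)) :=
        lin_ext fun u => by simp [linearize_asBlock_mul hh, h']
      have := LinearMap.congr_fun this (refineBlocks (monom s) * monom t)
      rw [ih hh'] at this
      simp only [LinearMap.comp_apply, LinearMap.mulLeft_apply, ← mul_assoc] at this
      rw [monom_cons, map_mul refineBlocks, show refineBlocks (X b) = asBlock (parts b) from aeval_X _ _, this]
      simp [h']
  have : linearize (fun r => h (r.map k)) ∘ₗ refineBlocks.toLinearMap =
      linearize (fun s => h (s.map fun b => linearize k (parts b))) :=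
    lin_ext fun s => by simpa using key s 0
  exact LinearMap.congr_fun this p

/-- The Faà di Bruno composition is associative. -/
theorem diBruno_assoc [AddCommMonoid C] [AddCommMonoid D] (f : Multiset A → B)
    (g : Multiset B → C) {h : Multiset C → D} (hh : IsAdditive h) (s : Multiset A) :
    diBruno (diBruno f g) h s = diBruno f (diBruno g h) s := by
  have : linearize (fun r => diBruno g h (r.map f)) =
      linearize (fun t => h (t.map fun r => g (r.map f))) ∘ₗ linearize parts := by
    refine lin_ext fun r => ?_
    simp only [LinearMap.comp_apply, linearize_monom]
    rw [diBruno, parts_map, linearize_rename]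
    simp only [Multiset.map_map, Function.comp_def]
  rw [diBruno, diBruno, this, LinearMap.comp_apply, linearize_parts_parts,
    linearize_refineBlocks hh]
  rfl

/-- Leibniz rule for one block, with `t` accumulating the blocks already passed over; later
inductions over blocks all run on this form. -/
theorem monom_mul_adjoin_cons (a : A) (b : Multiset A) (s t : Multiset (Multiset A)) :
    monom t * adjoin a (monom (b ::ₘ s)) =
      monom (b ::ₘ t) * adjoin a (monom s) + monom ((a ::ₘ b) ::ₘ (s + t)) := by
  have hst : monom (s + t) = monom s * monom t := by simp [monom]
  simp only [monom_cons, Derivation.leibniz, smul_eq_mul, adjoin_X, hst]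
  ring

/-- In every partition the distinguished letter lies in exactly one block; `f` is additive in the
letter and `g` in the value of that block. -/
theorem diBruno_isAdditive [AddCommMonoid A] [AddCommMonoid B] [AddCommMonoid C]
    {f : Multiset A → B} (hf : IsAdditive f) {g : Multiset B → C} (hg : IsAdditive g) :
    IsAdditive (diBruno f g) := by
  let φ := linearize fun r => g (r.map f)
  have hadd (a b : A) (s t : Multiset (Multiset A)) : φ (monom t * adjoin (a + b) (monom s)) =
      φ (monom t * adjoin a (monom s)) + φ (monom t * adjoin b (monom s)) := by
    induction s using Multiset.induction generalizing t with
    | empty => simp [adjoin]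
    | cons c s ih =>
      rw [monom_mul_adjoin_cons, monom_mul_adjoin_cons, monom_mul_adjoin_cons, map_add, map_add,
        map_add, ih]
      simp only [φ, linearize_monom, Multiset.map_cons, hf.add, hg.add]
      abel
  have hzero (s t : Multiset (Multiset A)) : φ (monom t * adjoin 0 (monom s)) = 0 := by
    induction s using Multiset.induction generalizing t with
    | empty => simp [adjoin]
    | cons c s ih =>
      rw [monom_mul_adjoin_cons, map_add, ih]
      simp only [φ, linearize_monom, Multiset.map_cons, hf.zero, hg.zero, add_zero]
  have hsing (a : A) : ({a} : Multiset A) = a ::ₘ 0 := rfl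
  have radd (a b : A) : φ ∘ₗ ins (a + b) = φ ∘ₗ ins a + φ ∘ₗ ins b := by
    refine lin_ext fun s => ?_
    have := hadd a b s 0
    simp only [monom_zero, one_mul] at this
    simp only [LinearMap.comp_apply, LinearMap.add_apply, ins_apply, map_add, this, ← monom_cons]
    simp only [φ, linearize_monom, Multiset.map_cons, hsing, hf.add, hg.add]
    abel
  have rzero : φ ∘ₗ ins 0 = 0 := by
    refine lin_ext fun s => ?_
    have := hzero s 0
    simp only [monom_zero, one_mul] at this
    simp only [LinearMap.comp_apply, LinearMap.zero_apply, ins_apply, map_add, this, ← monom_cons]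
    simp only [φ, linearize_monom, Multiset.map_cons, hsing, hf.zero, hg.zero, add_zero]
  constructor
  · intro a b s
    simpa [diBruno] using LinearMap.congr_fun (radd a b) (parts s)
  · intro s
    simpa [diBruno] using LinearMap.congr_fun rzero (parts s)

/-- Adjoining a letter to an existing block does not change the number of blocks. -/
theorem linearize_adjoin_eq_zero [AddCommMonoid C] {h : Multiset (Multiset A) → C} (a : A)
    (s t : Multiset (Multiset A)) (hh : ∀ r, r.card = s.card + t.card → h r = 0) :
    linearize h (monom t * adjoin a (monom s)) = 0 := by
  induction s using Multiset.induction generalizing t with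
  | empty => simp [adjoin]
  | cons b s ih =>
    rw [monom_mul_adjoin_cons, map_add, linearize_monom, ih, hh, add_zero]
    · simp; omega
    · intro r hr
      exact hh r (by simp at hr ⊢; omega)

/-- Only the partition with a single block contributes to a composite with a linear map. -/
theorem diBruno_right [AddCommMonoid C] (f : Multiset A → B) (g : Multiset B → C)
    (hg : ∀ s, s.card ≠ 1 → g s = 0) (s : Multiset A) (hs : s ≠ 0) :
    diBruno f g s = g {f s} := by
  classical
  -- As `g` sees only one-block partitions, a new block `{a}` survives only over the empty
  -- partition, and an enlarged block amounts to replacing `f` by `fun t => f (a ::ₘ t)`.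
  have hins (f : Multiset A → B) (a : A) : linearize (fun r => g (r.map f)) ∘ₗ ins a =
      linearize (fun r => if r = 0 then g {f {a}} else 0) +
        linearize (fun r => g (r.map fun t => f (a ::ₘ t))) := by
    refine lin_ext fun s => ?_
    simp only [LinearMap.comp_apply, LinearMap.add_apply, ins_apply, map_add, ← monom_cons,
      linearize_monom]
    congr 1
    · split_ifs with h
      · simp [h]
      · exact hg _ (by simpa using h)
    · by_cases h : s.card = 1
      · obtain ⟨b, rfl⟩ := Multiset.card_eq_one.1 h
        simp only [monom_singleton, adjoin_X]
        simp [← monom_singleton]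
      · rw [hg (s.map _) (by simpa using h)]
        simpa using linearize_adjoin_eq_zero (h := fun r => g (r.map f)) a s 0
          fun r hr => hg _ (by simpa [hr] using h)
  -- A partition obtained by insertion is never empty.
  have hconst (x : C) (a : A) : linearize (fun r => if r = 0 then x else 0) ∘ₗ ins a = 0 := by
    refine lin_ext fun s => ?_
    simp only [LinearMap.comp_apply, LinearMap.zero_apply, ins_apply, map_add, ← monom_cons,
      linearize_monom]
    rw [if_neg (Multiset.cons_ne_zero), zero_add]
    by_cases h : s = 0
    · simp [h, adjoin]
    · simpa using linearize_adjoin_eq_zero (h := fun r => if r = 0 then x else 0) a s 0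
        fun r hr => if_neg (by rintro rfl; exact h (Multiset.card_eq_zero.1 (by simpa using hr.symm)))
  obtain ⟨a, s, rfl⟩ : ∃ a t, s = a ::ₘ t := by
    induction s using Multiset.induction with
    | empty => exact absurd rfl hs
    | cons a s => exact ⟨a, s, rfl⟩
  clear hs
  induction s using Multiset.induction generalizing a f with
  | empty =>
    have := LinearMap.congr_fun (hins f a) (monom 0)
    simp only [LinearMap.comp_apply, LinearMap.add_apply, linearize_monom] at this
    rw [diBruno, parts_cons, parts_zero, ← monom_zero, this, Multiset.map_zero, hg 0 (by simp)]
    simp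
  | cons b s ih =>
    have h1 := LinearMap.congr_fun (hins f a) (parts (b ::ₘ s))
    have h2 := LinearMap.congr_fun (hconst (g {f {a}}) b) (parts s)
    have h3 := ih (fun t => f (a ::ₘ t)) b
    simp only [diBruno, LinearMap.comp_apply, LinearMap.add_apply, LinearMap.zero_apply,
      parts_cons] at h1 h2 h3 ⊢
    rw [h1, h2, h3, zero_add]

/-- The span of the partitions into nonempty blocks. -/
def nonemptyParts (A : Type*) : Submodule ℕ (MvPolynomial (Multiset A) ℕ) :=
  Submodule.span ℕ (monom '' {s | 0 ∉ s})

theorem monom_mem_nonemptyParts {s : Multiset (Multiset A)} (hs : 0 ∉ s) :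
    monom s ∈ nonemptyParts A :=
  Submodule.subset_span ⟨s, hs, rfl⟩

theorem ins_mem_nonemptyParts (a : A) {p : MvPolynomial (Multiset A) ℕ}
    (hp : p ∈ nonemptyParts A) : ins a p ∈ nonemptyParts A := by
  induction hp using Submodule.span_induction with
  | zero => simp
  | add p q _ _ hp hq => rw [map_add]; exact add_mem hp hq
  | smul n p _ hp => rw [map_smul]; exact Submodule.smul_mem _ n hp
  | mem p hp =>
    obtain ⟨s, hs, rfl⟩ := hp
    rw [ins_apply, ← monom_cons]
    refine add_mem (monom_mem_nonemptyParts (by simpa using hs)) ?_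
    have (t : Multiset (Multiset A)) (ht : 0 ∉ t) :
        monom t * adjoin a (monom s) ∈ nonemptyParts A := by
      induction s using Multiset.induction generalizing t with
      | empty => simp [adjoin]
      | cons b s ih =>
        simp only [Set.mem_ofPred_eq, Multiset.mem_cons, not_or] at hs
        rw [monom_mul_adjoin_cons]
        exact add_mem (ih hs.2 _ (by simp [ht, hs.1]))
          (monom_mem_nonemptyParts (by simp [ht, hs.2]))
    simpa using this 0 (by simp)

theorem parts_mem_nonemptyParts (s : Multiset A) : parts s ∈ nonemptyParts A := by
  induction s using Multiset.induction with
  | empty => simpa using monom_mem_nonemptyParts (A := A) (s := 0) (by simp)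
  | cons a s ih => exact parts_cons a s ▸ ins_mem_nonemptyParts a ih

/-- Only the partition into singletons contributes to a composite with a linear map. -/
theorem diBruno_left [AddCommMonoid B] [AddCommMonoid C] (f : Multiset A → B)
    (hf : ∀ s, 1 < s.card → f s = 0) {g : Multiset B → C} (hg : IsAdditive g) (s : Multiset A) :
    diBruno f g s = g (s.map fun a => f {a}) := by
  -- Enlarging a nonempty block gives one with at least two letters, which `f` kills; hence the
  -- restriction to `nonemptyParts`.
  have hadj {g : Multiset B → C} (hg : IsAdditive g) (a : A) {p : MvPolynomial (Multiset A) ℕ}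
      (hp : p ∈ nonemptyParts A) : linearize (fun r => g (r.map f)) (adjoin a p) = 0 := by
    induction hp using Submodule.span_induction with
    | zero => simp
    | add p q _ _ hp hq => rw [map_add, map_add, hp, hq, add_zero]
    | smul n p _ hp => rw [Derivation.map_smul, map_smul, hp, smul_zero]
    | mem p hp =>
      obtain ⟨s, hs, rfl⟩ := hp
      have (t : Multiset (Multiset A)) :
          linearize (fun r => g (r.map f)) (monom t * adjoin a (monom s)) = 0 := by
        induction s using Multiset.induction generalizing t with
        | empty => simp [adjoin]
        | cons b s ih =>
          simp only [Set.mem_ofPred_eq, Multiset.mem_cons, not_or] at hs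
          have hb : f (a ::ₘ b) = 0 := hf _ (by simpa using Multiset.card_pos.2 (Ne.symm hs.1))
          rw [monom_mul_adjoin_cons, map_add, ih hs.2, linearize_monom, Multiset.map_cons, hb,
            hg.zero, add_zero]
      simpa using this 0
  induction s using Multiset.induction generalizing g with
  | empty =>
    rw [diBruno, parts_zero, ← monom_zero, linearize_monom, Multiset.map_zero, Multiset.map_zero]
  | cons a s ih =>
    have hg' : IsAdditive fun u => g (f {a} ::ₘ u) :=
      ⟨fun b c u => by simp only [Multiset.cons_swap _ _ u, hg.add],
        fun u => by simp only [Multiset.cons_swap _ _ u, hg.zero]⟩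
    have : linearize (fun r => g (r.map f)) ∘ₗ LinearMap.mulLeft ℕ (X {a}) =
        linearize (fun r => g (f {a} ::ₘ r.map f)) :=
      lin_ext fun u => by simp [← monom_cons]
    have h1 := LinearMap.congr_fun this (parts s)
    simp only [LinearMap.comp_apply, LinearMap.mulLeft_apply] at h1
    rw [diBruno, parts_cons, ins_apply, map_add, hadj hg a (parts_mem_nonemptyParts s), add_zero,
      h1, Multiset.map_cons, ← ih hg', diBruno]

end Compose

/-! ### Ordered finite partitions compute the partition polynomial -/

section Ordered

open Finset

theorem monom_univ {I V : Type*} [Fintype I] (b : I → V) :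
    monom (univ.val.map b) = ∏ i, X (b i) := by
  simp only [monom, Multiset.map_map, Finset.prod, Function.comp_def]

theorem adjoin_prod {I α : Type*} [DecidableEq I] (a : α) (b : I → Multiset α) (s : Finset I) :
    adjoin a (∏ i ∈ s, X (b i)) =
      ∑ k ∈ s, ∏ i ∈ s, X (Function.update b k (a ::ₘ b k) i) := by
  induction s using Finset.induction_on with
  | empty => simp [adjoin]
  | insert k s hk ih =>
    rw [prod_insert hk, sum_insert hk, prod_insert hk, Derivation.leibniz, ih, Function.update_self,
      adjoin_X, smul_eq_mul, smul_eq_mul, mul_sum, add_comm, mul_comm]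
    congr 1
    · congr 1
      refine prod_congr rfl fun i hi => ?_
      rw [Function.update_of_ne (ne_of_mem_of_not_mem hi hk)]
    · refine sum_congr rfl fun i hi => ?_
      rw [prod_insert hk, Function.update_of_ne (ne_of_mem_of_not_mem hi hk).symm]

theorem univ_map_cast {p q : ℕ} (h : p = q) {α : Type*} (f : Fin q → α) :
    univ.val.map (fun i : Fin p => f (Fin.cast h i)) = univ.val.map f := by
  subst h
  rfl

theorem univ_map_succ {n : ℕ} {α : Type*} (f : Fin (n + 1) → α) :
    univ.val.map f = f 0 ::ₘ univ.val.map fun i : Fin n => f i.succ := by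
  rw [Fin.univ_val_map, Fin.univ_val_map, List.ofFn_succ, Multiset.cons_coe]

theorem extendMiddle_block {α : Type*} {n : ℕ} (a : Fin (n + 1) → α) (c : OrderedFinpartition n)
    (k m : Fin c.length) :
    (univ.val.map fun j => a ((c.extendMiddle k).emb m j)) =
      Function.update (fun m => univ.val.map fun j => a (c.emb m j).succ) k
        (a 0 ::ₘ univ.val.map fun j => a (c.emb k j).succ) m := by
  by_cases h : m = k
  · subst h
    have hp : (c.extendMiddle m).partSize m = c.partSize m + 1 := by
      simp [OrderedFinpartition.extendMiddle]
    have he : (c.extendMiddle m).emb m =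
        Fin.cases 0 (Fin.succ ∘ c.emb m) ∘ Fin.cast hp := dif_pos rfl
    rw [he, Function.update_self]
    refine (univ_map_cast hp fun i => a (Fin.cases 0 (Fin.succ ∘ c.emb m) i)).trans ?_
    rw [univ_map_succ]
    rfl
  · have hp : (c.extendMiddle k).partSize m = c.partSize m := by
      simp [OrderedFinpartition.extendMiddle, h]
    have he : (c.extendMiddle k).emb m = Fin.succ ∘ c.emb m ∘ Fin.cast hp := dif_neg h
    rw [he, Function.update_of_ne h]
    exact univ_map_cast hp fun i => a (c.emb m i).succ

/-- `OrderedFinpartition.extendEquiv` builds each partition of `n + 1` by making `0` a singleton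
block or adding it to an old block, which is exactly the recursion `ins`. -/
theorem sum_orderedFinpartition {α : Type*} (n : ℕ) (a : Fin n → α) :
    ∑ c : OrderedFinpartition n, monom (univ.val.map fun m => univ.val.map fun j => a (c.emb m j)) =
      parts (univ.val.map a) := by
  induction n with
  | zero =>
    rw [Fintype.sum_unique]
    have : (default : OrderedFinpartition 0).length = 0 := by simp
    have : IsEmpty (Fin (default : OrderedFinpartition 0).length) := by rw [this]; infer_instance
    rw [univ_eq_empty, univ_eq_empty]
    simp
  | succ n ih =>
    rw [univ_map_succ, parts_cons, ← ih, map_sum, ← (OrderedFinpartition.extendEquiv n).sum_comp,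
      Fintype.sum_sigma]
    refine sum_congr rfl fun c _ => ?_
    rw [Fintype.sum_option, ins_apply, ← monom_cons, monom_univ
        fun m => univ.val.map fun j => a (c.emb m j).succ, adjoin_prod]
    congr 1
    · congr 1
      exact univ_map_succ (n := c.length)
        fun m => univ.val.map fun j => a (c.extendLeft.emb m j)
    · refine sum_congr rfl fun k _ => ?_
      rw [← monom_univ]
      congr 2
      funext m
      exact extendMiddle_block a c k m

end Ordered

end

end Faa

namespace Faa

noncomputable section

open Finset

/-! ### Generalized elements of powers -/

section Tuples

variable {C : Type u} [Category.{v} C] [CartesianMonoidalCategory C] {A X B T S : C}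

theorem comp_tuple (t : S ⟶ T) (n : ℕ) (a : Fin n → (T ⟶ A)) (x : T ⟶ X) :
    t ≫ tuple n a x = tuple n (fun i => t ≫ a i) (t ≫ x) := by
  induction n with
  | zero => rfl
  | succ n ih =>
    exact (comp_lift t (a 0) (tuple n (fun i => a i.succ) x)).trans (congrArg _ (ih _))

@[simp]
theorem tuple_proj (n : ℕ) (a : Fin n → (T ⟶ A)) (x : T ⟶ X) (i : Fin n) :
    tuple n a x ≫ proj A X n i = a i := by
  induction n with
  | zero => exact i.elim0
  | succ n ih =>
    refine Fin.cases ?_ (fun i => ?_) i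
    · exact lift_fst _ _
    · exact (lift_snd_assoc _ _ _).trans (ih (fun i => a i.succ) i)

@[simp]
theorem tuple_proj_assoc (n : ℕ) (a : Fin n → (T ⟶ A)) (x : T ⟶ X) (i : Fin n) (f : A ⟶ B) :
    tuple n a x ≫ proj A X n i ≫ f = a i ≫ f := by
  rw [← Category.assoc, tuple_proj]

@[simp]
theorem tuple_last (n : ℕ) (a : Fin n → (T ⟶ A)) (x : T ⟶ X) : tuple n a x ≫ last A X n = x := by
  induction n with
  | zero => exact Category.comp_id x
  | succ n ih => exact (lift_snd_assoc _ _ _).trans (ih fun i => a i.succ)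

@[simp]
theorem tuple_last_assoc (n : ℕ) (a : Fin n → (T ⟶ A)) (x : T ⟶ X) (f : X ⟶ B) :
    tuple n a x ≫ last A X n ≫ f = x ≫ f := by
  rw [← Category.assoc, tuple_last]

theorem tuple_proj_last (n : ℕ) : tuple n (proj A X n) (last A X n) = 𝟙 (pow A X n) := by
  induction n with
  | zero => rfl
  | succ n ih =>
    have := comp_tuple (snd A (pow A X n)) n (proj A X n) (last A X n)
    rw [ih, Category.comp_id] at this
    exact (congrArg (lift (fst A (pow A X n))) this.symm).trans lift_fst_snd

theorem eq_tuple (n : ℕ) (t : T ⟶ pow A X n) :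
    t = tuple n (fun i => t ≫ proj A X n i) (t ≫ last A X n) := by
  rw [← comp_tuple, tuple_proj_last, Category.comp_id]

end Tuples

variable {C : Type u} [Category.{v} C] [CartesianMonoidalCategory C] [BraidedCategory C]

/-! ### Arrows as functions of multisets of generalized elements -/

theorem exists_univ_map {α : Type*} (s : Multiset α) :
    ∃ a : Fin s.card → α, s = univ.val.map a := by
  induction s using Quotient.inductionOn with
  | h l => exact ⟨l.get,
      (congrArg Multiset.ofList (List.ofFn_get l).symm).trans (Fin.univ_val_map _).symm⟩

/-- Equal multiplicities mean equinumerous fibres, and bijections between fibres glue to a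
permutation. -/
theorem exists_perm {I α : Type*} [Fintype I] {a b : I → α}
    (h : univ.val.map a = univ.val.map b) : ∃ s : Equiv.Perm I, b = a ∘ s := by
  classical
  have hc (f : I → α) (y : α) : Fintype.card {i // f i = y} = (univ.val.map f).count y := by
    rw [Multiset.count_map, Fintype.card_subtype]
    simp only [eq_comm, Finset.card, Finset.filter]
  have e (y : α) : {i // b i = y} ≃ {i // a i = y} :=
    Fintype.equivOfCardEq (by rw [hc, hc, h])
  exact ⟨Equiv.ofFiberEquiv e, funext fun i => (Equiv.ofFiberEquiv_map e i).symm⟩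

theorem univ_map_update {I α : Type*} [Fintype I] [DecidableEq I] (a : I → α) (i : I) (b : α) :
    univ.val.map (Function.update a i b) = b ::ₘ (univ.erase i).val.map a := by
  rw [← insert_erase (mem_univ i), insert_val_of_notMem (notMem_erase i _), Multiset.map_cons,
    Function.update_self, erase_insert (notMem_erase i _)]
  congr 1
  exact Multiset.map_congr rfl fun j hj => Function.update_of_ne (ne_of_mem_erase hj) _ _

theorem isMultiadditive_of_isAdditive {A X B : C} [AddMonObj A] [IsCommAddMonObj A]
    [AddMonObj B] [IsCommAddMonObj B] {n : ℕ}
    {f : pow A X n ⟶ B} (φ : ∀ (T : C), (T ⟶ X) → Multiset (T ⟶ A) → (T ⟶ B))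
    (hφ : ∀ T x, IsAdditive (φ T x)) (h : ∀ T a x, tuple n a x ≫ f = φ T x (univ.val.map a)) :
    IsMultiadditive f := by
  intro T a x i
  simp only [h, univ_map_update]
  exact ⟨fun b c => (hφ T x).add b c _, (hφ T x).zero _⟩

omit [BraidedCategory C] in
theorem isSymmetric_of_multiset {A X B : C} {n : ℕ}
    {f : pow A X n ⟶ B} (φ : ∀ (T : C), (T ⟶ X) → Multiset (T ⟶ A) → (T ⟶ B))
    (h : ∀ T a x, tuple n a x ≫ f = φ T x (univ.val.map a)) : IsSymmetric f := by
  intro T a x s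
  rw [h, h]
  congr 1
  have := congrArg (Multiset.map a) (Multiset.map_univ_val_equiv s)
  rwa [Multiset.map_map] at this

variable {P Q R S : Obj C} {T : C}

namespace Hom

/-- The component `fₙ`, for a natural number `n > 0`. -/
def component (f : Hom P Q) (n : ℕ) (hn : 0 < n) : pow P.vec P.base n ⟶ Q.vec := f.map ⟨n, hn⟩

theorem component_isMultiadditive (f : Hom P Q) (n : ℕ) (hn : 0 < n) :
    IsMultiadditive (f.component n hn) := f.additive ⟨n, hn⟩

theorem component_isSymmetric (f : Hom P Q) (n : ℕ) (hn : 0 < n) :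
    IsSymmetric (f.component n hn) := f.symmetric ⟨n, hn⟩

/-- The components `f₁, f₂, …` evaluated at generalized elements, as a single function of
multisets. -/
def eval (f : Hom P Q) (x : T ⟶ P.base) (s : Multiset (T ⟶ P.vec)) : T ⟶ Q.vec :=
  if h : 0 < s.card then tuple s.card (exists_univ_map s).choose x ≫ f.component s.card h else 0

@[simp]
theorem eval_zero (f : Hom P Q) (x : T ⟶ P.base) : f.eval x 0 = 0 := dif_neg (by simp)

/-- Symmetry of the component makes the enumeration chosen in `eval` irrelevant. -/
theorem eval_univ (f : Hom P Q) (x : T ⟶ P.base) {n : ℕ} (hn : 0 < n) (a : Fin n → (T ⟶ P.vec)) :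
    f.eval x (univ.val.map a) = tuple n a x ≫ f.component n hn := by
  have key (m : ℕ) (hm : 0 < m) (b : Fin m → (T ⟶ P.vec))
      (hb : univ.val.map a = univ.val.map b) :
      tuple m b x ≫ f.component m hm = tuple n a x ≫ f.component n hn := by
    obtain rfl : n = m := by simpa using congrArg Multiset.card hb
    obtain ⟨s, rfl⟩ := exists_perm hb
    exact f.component_isSymmetric n _ T a x s
  have hn : 0 < (univ.val.map a).card := by simpa using hn
  rw [eval, dif_pos hn]
  exact key _ hn _ (exists_univ_map (univ.val.map a)).choose_spec

theorem eval_isAdditive (f : Hom P Q) (x : T ⟶ P.base) : IsAdditive (f.eval x) := by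
  have key (s : Multiset (T ⟶ P.vec)) : ∃ (n : ℕ) (hn : 0 < n) (i : Fin n)
      (a : Fin n → (T ⟶ P.vec)),
      ∀ b, f.eval x (b ::ₘ s) = tuple n (Function.update a i b) x ≫ f.component n hn := by
    obtain ⟨a, ha⟩ := exists_univ_map s
    refine ⟨s.card + 1, Nat.succ_pos _, 0, Fin.cons 0 a, fun b => ?_⟩
    rw [← eval_univ, Fin.update_cons_zero, univ_map_succ]
    exact congrArg (fun t => f.eval x (b ::ₘ t)) ha
  constructor
  · intro b c s
    obtain ⟨n, hn, i, a, h⟩ := key s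
    rw [h, h, h]
    exact (f.component_isMultiadditive n hn T a x i).1 b c
  · intro s
    obtain ⟨n, hn, i, a, h⟩ := key s
    rw [h]
    exact (f.component_isMultiadditive n hn T a x i).2

theorem ext' {f g : Hom P Q} (h : f.star = g.star) (h' : ∀ n, f.map n = g.map n) : f = g := by
  cases f
  cases g
  obtain rfl : _ = _ := h
  obtain rfl := funext h'
  rfl

/-- Yoneda: evaluating at the projections of `Aⁿ × X` recovers the component itself. The empty
multiset corresponds to no component. -/
theorem ext_eval {f g : Hom P Q} (h : f.star = g.star)
    (h' : ∀ (T : C) (x : T ⟶ P.base) (s : Multiset (T ⟶ P.vec)), s ≠ 0 →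
      f.eval x s = g.eval x s) : f = g := by
  refine ext' h fun n => ?_
  have := h' _ (last P.vec P.base n) (univ.val.map (proj P.vec P.base n)) (by
    rw [← Multiset.card_pos]; simp)
  rwa [eval_univ _ _ n.pos, eval_univ _ _ n.pos, tuple_proj_last, Category.id_comp,
    Category.id_comp] at this

theorem eval_eq (f : Hom P Q) (x : T ⟶ P.base) {φ : Multiset (T ⟶ P.vec) → (T ⟶ Q.vec)}
    (h0 : φ 0 = 0) (h : ∀ (n : ℕ+) (a : Fin n → _), tuple n a x ≫ f.map n = φ (univ.val.map a)) :
    f.eval x = φ := by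
  funext s
  by_cases hs : s = 0
  · rw [hs, h0, eval_zero]
  · obtain ⟨a, ha⟩ := exists_univ_map s
    have hs := Multiset.card_pos.2 hs
    have key := (f.eval_univ x hs a).trans (h ⟨_, hs⟩ a)
    exact (congrArg (f.eval x) ha).trans (key.trans (congrArg φ ha.symm))

end Hom

theorem comp_sum {B T S : C} [AddMonObj B] [IsCommAddMonObj B] {I : Type*} (t : T ⟶ S)
    (s : Finset I) (f : I → (S ⟶ B)) : t ≫ ∑ i ∈ s, f i = ∑ i ∈ s, t ≫ f i :=
  map_sum (⟨⟨fun f => t ≫ f, AddMonObj.comp_zero t⟩, AddMonObj.comp_add t⟩ :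
    (S ⟶ B) →+ (T ⟶ B)) f s

theorem sum_eq_diBruno {A B C : Type*} [AddCommMonoid C] (f : Multiset A → B) (g : Multiset B → C)
    (n : ℕ) (a : Fin n → A) :
    ∑ c : OrderedFinpartition n,
      g (univ.val.map fun m => f (univ.val.map fun j => a (c.emb m j))) =
    diBruno f g (univ.val.map a) := by
  simp only [diBruno, ← sum_orderedFinpartition, map_sum, linearize_monom, Multiset.map_map,
    Function.comp_def]

theorem compTerm_eq (f : Hom P Q) (g : Hom Q R) (n : ℕ+) (c : OrderedFinpartition n) :
    compTerm f g n c = tuple c.length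
      (fun m => tuple (c.partSize m) (fun j => proj P.vec P.base n (c.emb m j))
        (last P.vec P.base n) ≫ f.component (c.partSize m) (c.partSize_pos m))
      (last P.vec P.base n ≫ f.star) ≫ g.component c.length (c.length_pos n.pos) := rfl

theorem tuple_compTerm (f : Hom P Q) (g : Hom Q R) (n : ℕ+) (c : OrderedFinpartition n)
    (a : Fin n → (T ⟶ P.vec)) (x : T ⟶ P.base) :
    tuple n a x ≫ compTerm f g n c = g.eval (x ≫ f.star)
      (univ.val.map fun m => f.eval x (univ.val.map fun j => a (c.emb m j))) := by
  have h (m : Fin c.length) : tuple n a x ≫ tuple (c.partSize m)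
      (fun j => proj P.vec P.base n (c.emb m j)) (last P.vec P.base n) ≫
        f.component (c.partSize m) (c.partSize_pos m) =
      f.eval x (univ.val.map fun j => a (c.emb m j)) := by
    rw [← Category.assoc, comp_tuple, f.eval_univ x (c.partSize_pos m)]
    simp only [tuple_proj, tuple_last]
  rw [compTerm_eq, ← Category.assoc, comp_tuple, g.eval_univ _ (c.length_pos n.pos)]
  simp only [h, tuple_last_assoc]

theorem tuple_sum_compTerm (f : Hom P Q) (g : Hom Q R) (n : ℕ+)
    (a : Fin n → (T ⟶ P.vec)) (x : T ⟶ P.base) :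
    tuple n a x ≫ ∑ c : OrderedFinpartition n, compTerm f g n c =
      diBruno (f.eval x) (g.eval (x ≫ f.star)) (univ.val.map a) := by
  simp only [comp_sum, tuple_compTerm]
  exact sum_eq_diBruno (f.eval x) (g.eval (x ≫ f.star)) n a

/-! ### Composition, linear arrows and pairing -/

namespace Hom

/-- Construct an arrow from its values on generalized elements. -/
@[simps]
def ofEval (star : P.base ⟶ Q.base) (map : ∀ n : ℕ+, pow P.vec P.base n ⟶ Q.vec)
    (φ : ∀ T : C, (T ⟶ P.base) → Multiset (T ⟶ P.vec) → (T ⟶ Q.vec))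
    (hφ : ∀ T x, IsAdditive (φ T x))
    (h : ∀ (n : ℕ+) (T) (a : Fin n → (T ⟶ P.vec)) (x : T ⟶ P.base),
      tuple n a x ≫ map n = φ T x (univ.val.map a)) : Hom P Q where
  star := star
  map := map
  additive n := isMultiadditive_of_isAdditive φ hφ (h n)
  symmetric n := isSymmetric_of_multiset φ (h n)

/-- The composite given by the Faà di Bruno formula. -/
def comp (f : Hom P Q) (g : Hom Q R) : Hom P R :=
  ofEval (f.star ≫ g.star) (fun n => ∑ c : OrderedFinpartition n, compTerm f g n c)
    (fun _ x => diBruno (f.eval x) (g.eval (x ≫ f.star)))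
    (fun _ x => diBruno_isAdditive (f.eval_isAdditive x) (g.eval_isAdditive _))
    (fun n _ a x => tuple_sum_compTerm f g n a x)

@[simp]
theorem comp_star (f : Hom P Q) (g : Hom Q R) : (comp f g).star = f.star ≫ g.star := rfl

theorem comp_map (f : Hom P Q) (g : Hom Q R) (n : ℕ+) :
    (comp f g).map n = ∑ c : OrderedFinpartition n, compTerm f g n c := rfl

theorem eval_comp (f : Hom P Q) (g : Hom Q R) (x : T ⟶ P.base) :
    (comp f g).eval x = diBruno (f.eval x) (g.eval (x ≫ f.star)) := by
  refine eval_eq _ _ ?_ fun n a => tuple_sum_compTerm f g n a x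
  rw [diBruno, parts_zero, ← monom_zero, linearize_monom, Multiset.map_zero, eval_zero]

theorem assoc (f : Hom P Q) (g : Hom Q R) (h : Hom R S) :
    comp (comp f g) h = comp f (comp g h) := by
  refine ext_eval (Category.assoc _ _ _) fun T x s _ => ?_
  simp only [eval_comp, comp_star, ← Category.assoc]
  exact diBruno_assoc _ _ (h.eval_isAdditive _) s

/-- The values of the linear arrow with linear part `k`. -/
def linearEval (k : P.vec ⟶ Q.vec) (s : Multiset (T ⟶ P.vec)) : T ⟶ Q.vec :=
  if s.card = 1 then (s.map (· ≫ k)).sum else 0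

@[simp]
theorem linearEval_singleton (k : P.vec ⟶ Q.vec) (a : T ⟶ P.vec) :
    linearEval k {a} = a ≫ k := by
  simp [linearEval]

theorem linearEval_of_ne (k : P.vec ⟶ Q.vec) {s : Multiset (T ⟶ P.vec)} (hs : s.card ≠ 1) :
    linearEval k s = 0 := if_neg hs

theorem linearEval_isAdditive (k : P.vec ⟶ Q.vec) [IsAddMonHom k] :
    IsAdditive (linearEval (T := T) k) := by
  constructor
  · intro b c s
    by_cases hs : s = 0
    · simp [hs, AddMonObj.add_comp]
    · simp [linearEval, hs]
  · intro s
    by_cases hs : s = 0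
    · simp [hs]
    · simp [linearEval, hs]

theorem tuple_linear (k : P.vec ⟶ Q.vec) (n : ℕ+) (a : Fin n → (T ⟶ P.vec)) (x : T ⟶ P.base) :
    tuple n a x ≫ linear P Q k n = linearEval k (univ.val.map a) := by
  by_cases hn : n = 1
  · subst hn
    rw [linear, if_pos rfl, tuple_proj_assoc]
    exact (linearEval_singleton k (a 0)).symm
  · rw [linear, if_neg hn, AddMonObj.comp_zero, linearEval_of_ne]
    simpa using hn

/-- The arrow `(k_*, π₀ k, 0, 0, …)` for an additive map `k`. -/
def ofLinear (star : P.base ⟶ Q.base) (k : P.vec ⟶ Q.vec) [IsAddMonHom k] : Hom P Q :=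
  ofEval star (linear P Q k) (fun _ _ => linearEval k) (fun _ _ => linearEval_isAdditive k)
    (fun n _ a x => tuple_linear k n a x)

@[simp]
theorem ofLinear_star (star : P.base ⟶ Q.base) (k : P.vec ⟶ Q.vec) [IsAddMonHom k] :
    (ofLinear star k).star = star := rfl

theorem eval_ofLinear (star : P.base ⟶ Q.base) (k : P.vec ⟶ Q.vec) [IsAddMonHom k]
    (x : T ⟶ P.base) : (ofLinear star k).eval x = linearEval k :=
  eval_eq _ _ (linearEval_of_ne k (by simp)) fun n a => tuple_linear k n a x

theorem id_comp (f : Hom P Q) : comp (ofLinear (𝟙 P.base) (𝟙 P.vec)) f = f := by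
  refine ext_eval (Category.id_comp _) fun T x s hs => ?_
  rw [eval_comp, eval_ofLinear, ofLinear_star, Category.comp_id,
    diBruno_left _ (fun s hs => linearEval_of_ne _ hs.ne') (f.eval_isAdditive x)]
  simp

theorem eval_comp_ofLinear (f : Hom P Q) (star : Q.base ⟶ R.base) (k : Q.vec ⟶ R.vec)
    [IsAddMonHom k] (x : T ⟶ P.base) (s : Multiset (T ⟶ P.vec)) (hs : s ≠ 0) :
    (comp f (ofLinear star k)).eval x s = f.eval x s ≫ k := by
  rw [eval_comp, eval_ofLinear, diBruno_right _ _ (fun s hs => linearEval_of_ne _ hs) s hs,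
    linearEval_singleton]

theorem comp_id (f : Hom P Q) : comp f (ofLinear (𝟙 Q.base) (𝟙 Q.vec)) = f :=
  ext_eval (Category.comp_id _) fun T x s hs => by
    rw [eval_comp_ofLinear _ _ _ _ _ hs, Category.comp_id]

/-- Applied to the projections, this reduces the universal property of the product to that of the
base category in each degree. -/
theorem map_comp_ofLinear (f : Hom P Q) (star : Q.base ⟶ R.base) (k : Q.vec ⟶ R.vec)
    [IsAddMonHom k] (n : ℕ+) : (comp f (ofLinear star k)).map n = f.map n ≫ k := by
  have := eval_comp_ofLinear f star k (last P.vec P.base n) (univ.val.map (proj P.vec P.base n))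
    (by rw [← Multiset.card_pos]; simp)
  rw [eval_univ _ _ n.pos, eval_univ _ _ n.pos, tuple_proj_last, Category.id_comp,
    Category.id_comp] at this
  exact this

instance isAddMonHom_fst (P Q : Obj C) :
    IsAddMonHom (show (prod P Q).vec ⟶ P.vec from fst P.vec Q.vec) :=
  inferInstanceAs (IsAddMonHom (fst P.vec Q.vec))

instance isAddMonHom_snd (P Q : Obj C) :
    IsAddMonHom (show (prod P Q).vec ⟶ Q.vec from snd P.vec Q.vec) :=
  inferInstanceAs (IsAddMonHom (snd P.vec Q.vec))

/-- The first projection. -/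
def projFst (P Q : Obj C) : Hom (prod P Q) P :=
  ofLinear (P := prod P Q) (Q := P) (fst P.base Q.base) (fst P.vec Q.vec)

/-- The second projection. -/
def projSnd (P Q : Obj C) : Hom (prod P Q) Q :=
  ofLinear (P := prod P Q) (Q := Q) (snd P.base Q.base) (snd P.vec Q.vec)

theorem prod_hom_add (f g : T ⟶ P.vec) (f' g' : T ⟶ Q.vec) :
    (show T ⟶ (prod P Q).vec from lift (f + g) (f' + g')) =
      (show T ⟶ (prod P Q).vec from lift f f') + (show T ⟶ (prod P Q).vec from lift g g') := by
  refine hom_ext _ _ ?_ ?_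
  · refine Eq.trans ?_ (AddMonObj.add_comp (N := P.vec) (show T ⟶ (prod P Q).vec from lift f f')
      (show T ⟶ (prod P Q).vec from lift g g')
      (show (prod P Q).vec ⟶ P.vec from fst P.vec Q.vec)).symm
    exact (lift_fst _ _).trans (congrArg₂ _ (lift_fst _ _).symm (lift_fst _ _).symm)
  · refine Eq.trans ?_ (AddMonObj.add_comp (N := Q.vec) (show T ⟶ (prod P Q).vec from lift f f')
      (show T ⟶ (prod P Q).vec from lift g g')
      (show (prod P Q).vec ⟶ Q.vec from snd P.vec Q.vec)).symm
    exact (lift_snd _ _).trans (congrArg₂ _ (lift_snd _ _).symm (lift_snd _ _).symm)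

theorem prod_hom_zero :
    (show T ⟶ (prod P Q).vec from lift (0 : T ⟶ P.vec) (0 : T ⟶ Q.vec)) = 0 := by
  refine hom_ext _ _ ?_ ?_
  · exact (lift_fst _ _).trans (AddMonObj.zero_comp (N := P.vec)
      (show (prod P Q).vec ⟶ P.vec from fst P.vec Q.vec)).symm
  · exact (lift_snd _ _).trans (AddMonObj.zero_comp (N := Q.vec)
      (show (prod P Q).vec ⟶ Q.vec from snd P.vec Q.vec)).symm

/-- The pairing of two arrows. -/
def pair (f : Hom S P) (g : Hom S Q) : Hom S (prod P Q) :=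
  ofEval (Q := prod P Q) (lift f.star g.star) (fun n => lift (f.map n) (g.map n))
    (fun _ x s => lift (f.eval x s) (g.eval x s))
    (fun T x => ⟨fun a b s => by
        rw [(f.eval_isAdditive x).add, (g.eval_isAdditive x).add]
        exact prod_hom_add _ _ _ _,
      fun s => by
        rw [(f.eval_isAdditive x).zero, (g.eval_isAdditive x).zero]
        exact prod_hom_zero⟩)
    (fun n T a x => by
      rw [eval_univ _ _ n.pos, eval_univ _ _ n.pos]
      exact comp_lift _ _ _)

/-- The unique arrow to the terminal object. -/
def terminal (P : Obj C) : Hom P unit :=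
  ofEval (Q := unit) (toUnit _) (fun _ => toUnit _) (fun T _ _ => toUnit T)
    (fun _ _ => ⟨fun _ _ _ => toUnit_unique _ _, fun _ => toUnit_unique _ _⟩)
    (fun _ _ _ _ => toUnit_unique _ _)

end Hom

variable (C) in
/-- The Cartesian structure given by the Faà di Bruno composition. -/
def cartesianStructure : CartesianStructure C where
  id P := Hom.ofLinear (𝟙 P.base) (𝟙 P.vec)
  comp := Hom.comp
  id_star _ := rfl
  id_map _ _ := rfl
  comp_star _ _ := rfl
  comp_map _ _ _ := rfl
  id_comp := Hom.id_comp
  comp_id := Hom.comp_id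
  assoc := Hom.assoc
  toUnit := Hom.terminal
  toUnit_unique _ := Hom.ext' (toUnit_unique _ _) fun _ => toUnit_unique _ _
  fst := Hom.projFst
  fst_star _ _ := rfl
  fst_map _ _ _ := rfl
  snd := Hom.projSnd
  snd_star _ _ := rfl
  snd_map _ _ _ := rfl
  lift := Hom.pair
  lift_fst _ _ := Hom.ext' (lift_fst _ _) fun n =>
    (Hom.map_comp_ofLinear _ _ _ n).trans (lift_fst _ _)
  lift_snd _ _ := Hom.ext' (lift_snd _ _) fun n =>
    (Hom.map_comp_ofLinear _ _ _ n).trans (lift_snd _ _)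
  lift_unique _ _ h h₁ h₂ := Hom.ext'
    (hom_ext _ _ ((congrArg Hom.star h₁).trans (lift_fst _ _).symm)
      ((congrArg Hom.star h₂).trans (lift_snd _ _).symm))
    fun n => hom_ext _ _
      (((Hom.map_comp_ofLinear h _ _ n).symm.trans (congrArg (Hom.map · n) h₁)).trans
        (lift_fst _ _).symm)
      (((Hom.map_comp_ofLinear h _ _ n).symm.trans (congrArg (Hom.map · n) h₂)).trans
        (lift_snd _ _).symm)

end

end Faa

/-! ### Strict functors are braided monoidal -/

namespace StrictCartFunctor

variable {C : Type u₁} [Category.{v₁} C] [CartesianMonoidalCategory C]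
  {D : Type u₂} [Category.{v₂} D] [CartesianMonoidalCategory D]

/-- Preservation of the projections as arrows says that the transport map has the same two
components as the comparison map. -/
theorem prodComparison_eq (F : StrictCartFunctor C D) (A B : C) :
    prodComparison F.toFunctor A B = eqToHom (F.obj_prod A B) := by
  have h₁ := (Arrow.mk_eq_mk_iff _ _).1 (F.map_fst A B)
  have h₂ := (Arrow.mk_eq_mk_iff _ _).1 (F.map_snd A B)
  obtain ⟨_, _, h₁⟩ := h₁
  obtain ⟨_, _, h₂⟩ := h₂
  refine hom_ext _ _ ?_ ?_
  · simpa using h₁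
  · simpa using h₂

theorem preservesFiniteProducts (F : StrictCartFunctor C D) :
    Limits.PreservesFiniteProducts F.toFunctor := by
  have (A B : C) : IsIso (prodComparison F.toFunctor A B) := by
    rw [prodComparison_eq]; infer_instance
  have : IsIso (terminalComparison F.toFunctor) := by
    rw [toUnit_unique (terminalComparison F.toFunctor) (eqToHom F.obj_unit)]; infer_instance
  have := preservesLimitsOfShape_discrete_walkingPair_of_isIso_prodComparison F.toFunctor
  have := preservesLimit_empty_of_isIso_terminalComparison F.toFunctor
  have := Limits.preservesLimitsOfShape_pempty_of_preservesTerminal F.toFunctor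
  exact .of_preserves_binary_and_terminal _

/-- A strict functor is braided monoidal. -/
@[reducible]
noncomputable def braided [BraidedCategory C] [BraidedCategory D] (F : StrictCartFunctor C D) :
    F.toFunctor.Braided :=
  haveI := F.preservesFiniteProducts
  Functor.Braided.ofChosenFiniteProducts F.toFunctor

attribute [local instance] braided

variable [BraidedCategory C] [BraidedCategory D]

theorem μ_eq (F : StrictCartFunctor C D) (A B : C) :
    Functor.LaxMonoidal.μ F.toFunctor A B = eqToHom (F.obj_prod A B).symm := by
  rw [← cancel_mono (Functor.OplaxMonoidal.δ F.toFunctor A B), Functor.Monoidal.μ_δ,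
    Functor.OplaxMonoidal.δ_of_cartesianMonoidalCategory, prodComparison_eq]
  simp

theorem ε_eq (F : StrictCartFunctor C D) :
    Functor.LaxMonoidal.ε F.toFunctor = eqToHom F.obj_unit.symm := by
  rw [← cancel_mono (Functor.OplaxMonoidal.η F.toFunctor)]
  exact toUnit_unique _ _

omit [BraidedCategory C] [BraidedCategory D] in
theorem ext_arrow {F G : StrictCartFunctor C D}
    (h : ∀ {A B : C} (f : A ⟶ B), Arrow.mk (F.map f) = Arrow.mk (G.map f)) : F = G := by
  have : F.toFunctor = G.toFunctor :=
    CategoryTheory.Functor.ext (fun A => congrArg (·.left) (h (𝟙 A))) fun A B f =>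
      ((Arrow.mk_eq_mk_iff _ _).1 (h f)).2.2
  cases F
  cases G
  obtain rfl : _ = _ := this
  rfl

end StrictCartFunctor

/-! ### Action of strict functors and the endofunctor -/

namespace Faa

noncomputable section

open Finset

attribute [local instance] StrictCartFunctor.braided
open scoped Obj

variable {C : Type u₁} [Category.{v₁} C] [CartesianMonoidalCategory C] [BraidedCategory C]
  {D : Type u₂} [Category.{v₂} D] [CartesianMonoidalCategory D] [BraidedCategory D]

/-- Only addition has to be compared, since it determines the zero of a monoid. -/
theorem Obj.ext_of_isAddMonHom {P Q : Obj C} (h : P.vec = Q.vec) (hb : P.base = Q.base)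
    (hh : IsAddMonHom (eqToHom h)) : P = Q := by
  obtain ⟨A, X⟩ := P
  obtain ⟨B, Y⟩ := Q
  dsimp only at h hb hh
  subst h hb
  have h2 := hh.add_hom
  simp only [eqToHom_refl, Category.comp_id, id_tensorHom_id, Category.id_comp] at h2
  obtain rfl := AddMonObj.ext _ _ h2
  rfl

instance isCommAddMonObj_map (F : StrictCartFunctor C D) (A : C) [AddMonObj A]
    [IsCommAddMonObj A] : IsCommAddMonObj (F.obj A) where
  add_comm := by
    rw [Functor.obj.σ_def, ← Functor.LaxBraided.braided_assoc, ← F.map_comp,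
      IsCommAddMonObj.add_comm]

theorem linear_of_ne (P Q : Obj C) (k : P.vec ⟶ Q.vec) {n : ℕ+} (hn : n ≠ 1) :
    linear P Q k n = 0 := if_neg hn

theorem Obj.ext_arrow {P Q : Obj C} (h : P.vec = Q.vec) (hb : P.base = Q.base)
    (hadd : Arrow.mk σ[P.vec] = Arrow.mk σ[Q.vec]) : P = Q := by
  obtain ⟨A, X⟩ := P
  obtain ⟨B, Y⟩ := Q
  dsimp only at h hb hadd
  subst h hb
  obtain rfl := AddMonObj.ext _ _ ((Arrow.mk_inj _ _).1 hadd)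
  rfl

/-- The action on objects of the functor induced by a strict functor. -/
def mapObj (F : StrictCartFunctor C D) (P : Obj C) : Obj D where
  vec := F.obj P.vec
  base := F.obj P.base

theorem arrow_mapObj_add (F : StrictCartFunctor C D) (P : Obj C) :
    Arrow.mk σ[(mapObj F P).vec] = Arrow.mk (F.map σ[P.vec]) := by
  change Arrow.mk (Functor.LaxMonoidal.μ F.toFunctor P.vec P.vec ≫ F.map σ[P.vec]) = _
  rw [StrictCartFunctor.μ_eq, Arrow.arrow_mk_eqToHom_comp]

theorem arrow_mapObj_zero (F : StrictCartFunctor C D) (P : Obj C) :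
    Arrow.mk ζ[(mapObj F P).vec] = Arrow.mk (F.map ζ[P.vec]) := by
  change Arrow.mk (Functor.LaxMonoidal.ε F.toFunctor ≫ F.map ζ[P.vec]) = _
  rw [StrictCartFunctor.ε_eq, Arrow.arrow_mk_eqToHom_comp]

omit [BraidedCategory C] [BraidedCategory D] in
theorem pow_eq (F : StrictCartFunctor C D) (A X : C) (n : ℕ) :
    pow (F.obj A) (F.obj X) n = F.obj (pow A X n) := by
  induction n with
  | zero => rfl
  | succ n ih => exact (congrArg _ ih).trans (F.obj_prod _ _).symm

/-- The canonical identification of powers. -/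
def powComparison (F : StrictCartFunctor C D) (A X : C) (n : ℕ) :
    pow (F.obj A) (F.obj X) n ⟶ F.obj (pow A X n) := eqToHom (pow_eq F A X n)

omit [BraidedCategory C] in
theorem eqToHom_whiskerLeft_eq {A X Y : C} (h : X = Y) :
    A ◁ eqToHom h = eqToHom (congrArg (A ⊗ ·) h) := by
  subst h; simp

theorem powComparison_succ (F : StrictCartFunctor C D) (A X : C) (n : ℕ) :
    powComparison F A X (n + 1) =
      (F.obj A ◁ powComparison F A X n) ≫ Functor.LaxMonoidal.μ F.toFunctor A (pow A X n) := by
  rw [powComparison, powComparison, eqToHom_whiskerLeft_eq, StrictCartFunctor.μ_eq, eqToHom_trans]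
  rfl

@[simp]
theorem powComparison_proj (F : StrictCartFunctor C D) (A X : C) (n : ℕ) (i : Fin n) :
    powComparison F A X n ≫ F.map (proj A X n i) = proj (F.obj A) (F.obj X) n i := by
  induction n with
  | zero => exact i.elim0
  | succ n ih =>
    rw [powComparison_succ]
    refine Fin.cases ?_ (fun i => ?_) i
    · change (_ ≫ _) ≫ F.map (fst A (pow A X n)) = fst _ _
      simp
    · change (_ ≫ _) ≫ F.map (snd A (pow A X n) ≫ proj A X n i) = snd _ _ ≫ proj _ _ n i
      simp [ih]

@[simp]
theorem powComparison_proj_assoc (F : StrictCartFunctor C D) (A X : C) (n : ℕ) (i : Fin n) {Y : D}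
    (f : F.obj A ⟶ Y) :
    powComparison F A X n ≫ F.map (proj A X n i) ≫ f = proj (F.obj A) (F.obj X) n i ≫ f := by
  rw [← Category.assoc, powComparison_proj]

@[simp]
theorem powComparison_last (F : StrictCartFunctor C D) (A X : C) (n : ℕ) :
    powComparison F A X n ≫ F.map (last A X n) = last (F.obj A) (F.obj X) n := by
  induction n with
  | zero => exact (Category.id_comp _).trans (F.map_id _)
  | succ n ih =>
    rw [powComparison_succ]
    change (_ ≫ _) ≫ F.map (snd A (pow A X n) ≫ last A X n) = snd _ _ ≫ last _ _ n
    simp [ih]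

@[simp]
theorem powComparison_last_assoc (F : StrictCartFunctor C D) (A X : C) (n : ℕ) {Y : D}
    (f : F.obj X ⟶ Y) :
    powComparison F A X n ≫ F.map (last A X n) ≫ f = last (F.obj A) (F.obj X) n ≫ f := by
  rw [← Category.assoc, powComparison_last]

/-- Transports to the target any identity stated on tuples; the extra `t` specializes generic
elements to arbitrary ones. -/
theorem map_tuple_comp (F : StrictCartFunctor C D) {A X B T : C} {T' : D} (t : T' ⟶ F.obj T)
    (n : ℕ) (a : Fin n → (T ⟶ A)) (x : T ⟶ X) (f : pow A X n ⟶ B) :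
    t ≫ F.map (tuple n a x ≫ f) =
      tuple n (fun i => t ≫ F.map (a i)) (t ≫ F.map x) ≫ powComparison F A X n ≫ F.map f := by
  have : t ≫ F.map (tuple n a x) ≫ eqToHom (pow_eq F A X n).symm =
      tuple n (fun i => t ≫ F.map (a i)) (t ≫ F.map x) := by
    rw [eq_tuple n (t ≫ F.map (tuple n a x) ≫ eqToHom (pow_eq F A X n).symm)]
    congr 1
    · funext i
      rw [← powComparison_proj, powComparison, Category.assoc, Category.assoc,
        eqToHom_trans_assoc, eqToHom_refl, Category.id_comp, ← F.map_comp, tuple_proj]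
    · rw [← powComparison_last, powComparison, Category.assoc, Category.assoc,
        eqToHom_trans_assoc, eqToHom_refl, Category.id_comp, ← F.map_comp, tuple_last]
  rw [← this, powComparison]
  simp

theorem isMultiadditive_map (F : StrictCartFunctor C D) {A X B : C} [AddMonObj A] [AddMonObj B]
    {n : ℕ} {f : pow A X n ⟶ B} (hf : IsMultiadditive f) :
    IsMultiadditive (powComparison F A X n ≫ F.map f) := by
  intro T a x i
  have key (b c : T ⟶ F.obj A) := by
    let s : T ⟶ F.obj (pow A X n) := tuple n (Function.update a i c) x ≫ powComparison F A X n
    -- Additivity in slot `i` is used at its universal instance over `A ⊗ pow A X n`: one summand is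
    -- the extra factor, the other is slot `i`. Its image under `F` is then pulled back along `t`,
    -- which specializes these to `b` and `c`.
    let t : T ⟶ F.obj (A ⊗ pow A X n) := lift b s ≫ Functor.LaxMonoidal.μ F.toFunctor _ _
    have hb : t ≫ F.map (fst A (pow A X n)) = b := by simp [t]
    have hc (j : Fin n) : t ≫ F.map (snd A (pow A X n) ≫ proj A X n j) =
        Function.update a i c j := by simp [t, s]
    have hx : t ≫ F.map (snd A (pow A X n) ≫ last A X n) = x := by simp [t, s]
    have hu (d : A ⊗ pow A X n ⟶ A) : (fun j => t ≫ F.map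
        (Function.update (fun j => snd A (pow A X n) ≫ proj A X n j) i d j)) =
        Function.update a i (t ≫ F.map d) := by
      funext j
      by_cases h : j = i
      · subst h; simp
      · rw [Function.update_of_ne h, Function.update_of_ne h, hc, Function.update_of_ne h]
    have H (d : A ⊗ pow A X n ⟶ A) : t ≫ F.map (tuple n (Function.update
        (fun j => snd A (pow A X n) ≫ proj A X n j) i d) (snd A (pow A X n) ≫ last A X n) ≫ f) =
        tuple n (Function.update a i (t ≫ F.map d)) x ≫ powComparison F A X n ≫ F.map f := by
      rw [map_tuple_comp, hu, hx]
    have h0 := hf _ (fun j => snd A (pow A X n) ≫ proj A X n j) (snd A (pow A X n) ≫ last A X n) i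
    have hadd := congrArg (fun g => t ≫ F.map g)
      (h0.1 (fst A (pow A X n)) (snd A (pow A X n) ≫ proj A X n i))
    have hzero := congrArg (fun g => t ≫ F.map g) h0.2
    simp only [H, F.map_add', AddMonObj.comp_add, hb, hc, Function.update_self] at hadd
    simp only [H, F.map_zero', AddMonObj.comp_zero] at hzero
    exact And.intro hadd hzero
  exact ⟨fun b c => (key b c).1, (key 0 0).2⟩

theorem isSymmetric_map (F : StrictCartFunctor C D) {A X B : C}
    {n : ℕ} {f : pow A X n ⟶ B} (hf : IsSymmetric f) :
    IsSymmetric (powComparison F A X n ≫ F.map f) := by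
  intro T a x s
  let t : T ⟶ F.obj (pow A X n) := tuple n a x ≫ powComparison F A X n
  have h := congrArg (fun g => t ≫ F.map g) (hf _ (proj A X n) (last A X n) s)
  simp only [map_tuple_comp] at h
  simpa [t] using h

/-- The action on arrows of the functor induced by a strict functor. -/
def mapHom (F : StrictCartFunctor C D) {P Q : Obj C} (f : Hom P Q) :
    Hom (mapObj F P) (mapObj F Q) where
  star := F.map f.star
  map n := powComparison F P.vec P.base n ≫ F.map (f.map n)
  additive n := isMultiadditive_map F (f.additive n)
  symmetric n := isSymmetric_map F (f.symmetric n)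

instance isAddMonHom_map (F : StrictCartFunctor C D) {P Q : Obj C} (k : P.vec ⟶ Q.vec)
    [IsAddMonHom k] :
    IsAddMonHom (show (mapObj F P).vec ⟶ (mapObj F Q).vec from F.map k) :=
  inferInstanceAs (IsAddMonHom (F.map k))

theorem mapHom_ofLinear (F : StrictCartFunctor C D) {P Q : Obj C} (star : P.base ⟶ Q.base)
    (k : P.vec ⟶ Q.vec) [IsAddMonHom k] :
    mapHom F (Hom.ofLinear star k) =
      Hom.ofLinear (P := mapObj F P) (Q := mapObj F Q) (F.map star) (F.map k) := by
  refine Hom.ext' rfl fun n => ?_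
  change powComparison F P.vec P.base n ≫ F.map (linear P Q k n) =
    linear (mapObj F P) (mapObj F Q) (F.map k) n
  by_cases hn : n = 1
  · subst hn
    exact (congrArg (powComparison F P.vec P.base 1 ≫ ·) (F.map_comp _ _)).trans
      (powComparison_proj_assoc F P.vec P.base 1 0 _)
  · rw [linear_of_ne _ _ _ hn, F.map_zero', AddMonObj.comp_zero]
    exact (linear_of_ne (mapObj F P) (mapObj F Q) _ hn).symm

/-- `F` preserves sums of maps into monoids and also tuples, so the formulas agree partition by
partition. -/
theorem mapHom_comp (F : StrictCartFunctor C D) {P Q R : Obj C} (f : Hom P Q) (g : Hom Q R) :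
    mapHom F (Hom.comp f g) = Hom.comp (mapHom F f) (mapHom F g) := by
  refine Hom.ext' (F.map_comp _ _) fun n => ?_
  change powComparison F P.vec P.base n ≫ F.map (∑ c, compTerm f g n c) =
    ∑ c : OrderedFinpartition n, compTerm (mapHom F f) (mapHom F g) n c
  have : F.map (∑ c, compTerm f g n c) = ∑ c, F.map (compTerm f g n c) :=
    map_sum (F.toFunctor.homAddMonoidHom (X := pow P.vec P.base n) (M := R.vec)) _ _
  rw [this, comp_sum]
  refine sum_congr rfl fun c _ => ?_
  rw [compTerm_eq, map_tuple_comp, F.map_comp, powComparison_last_assoc]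
  simp only [map_tuple_comp, powComparison_proj, powComparison_last]
  rfl

theorem mapObj_unit (F : StrictCartFunctor C D) : mapObj F (unit : Obj C) = unit :=
  Obj.ext_of_isAddMonHom F.obj_unit F.obj_unit
    { zero_hom := toUnit_unique _ _
      add_hom := toUnit_unique _ _ }

/-- The comparison map pairs two monoid homomorphisms, hence is one itself; being a transport, it
identifies the two monoid structures. -/
theorem mapObj_prod (F : StrictCartFunctor C D) (P Q : Obj C) :
    mapObj F (prod P Q) = prod (mapObj F P) (mapObj F Q) := by
  refine Obj.ext_of_isAddMonHom (F.obj_prod _ _) (F.obj_prod _ _) ?_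
  have h := F.prodComparison_eq P.vec Q.vec
  have : IsAddMonHom
      (prodComparison F.toFunctor P.vec Q.vec) :=
    inferInstanceAs (IsAddMonHom (lift (F.map (fst P.vec Q.vec)) (F.map (snd P.vec Q.vec))))
  rw [h] at this
  exact this

theorem mapObj_id (X : CartCat.{v, u}) (P : Obj X) : mapObj (𝟙 X : X ⟶ X) P = P :=
  Obj.ext_arrow rfl rfl (arrow_mapObj_add (𝟙 X : X ⟶ X) P)

theorem mapObj_comp {X Y Z : CartCat.{v, u}} (F : X ⟶ Y) (G : Y ⟶ Z) (P : Obj X) :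
    mapObj (F ≫ G) P = mapObj G (mapObj F P) :=
  Obj.ext_arrow rfl rfl ((arrow_mapObj_add (F ≫ G) P).trans
    ((arrow_mapObj_add G (mapObj F P)).trans
      (congrArg G.toFunctor.mapArrow.obj (arrow_mapObj_add F P))).symm)

section Arrows

variable {P Q P' Q' : Obj C}

theorem arrow_ext (S : CartesianStructure C) {f : Hom P Q} {f' : Hom P' Q'} (hP : P = P')
    (hQ : Q = Q') (hs : Arrow.mk f.star = Arrow.mk f'.star)
    (hm : ∀ n, Arrow.mk (f.map n) = Arrow.mk (f'.map n)) :
    letI := S.category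
    Arrow.mk (T := Obj C) f = Arrow.mk (T := Obj C) f' := by
  subst hP hQ
  congr 1
  exact Hom.ext' ((Arrow.mk_inj _ _).1 hs) fun n => (Arrow.mk_inj _ _).1 (hm n)

theorem arrow_ofLinear (S : CartesianStructure C) (hP : P = P')
    (hQ : Q = Q') (s : P.base ⟶ Q.base) (s' : P'.base ⟶ Q'.base) {k : P.vec ⟶ Q.vec}
    {k' : P'.vec ⟶ Q'.vec} [h : IsAddMonHom k] [h' : IsAddMonHom k']
    (hs : Arrow.mk s = Arrow.mk s') (hk : Arrow.mk k = Arrow.mk k') :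
    letI := S.category
    Arrow.mk (T := Obj C) (Hom.ofLinear s k) = Arrow.mk (T := Obj C) (Hom.ofLinear s' k') := by
  subst hP hQ
  obtain rfl := (Arrow.mk_inj _ _).1 hs
  obtain rfl := (Arrow.mk_inj _ _).1 hk
  rfl

end Arrows

/-- The strict functor induced by a strict functor. -/
def mapFunctor (F : StrictCartFunctor C D) :
    letI := (cartesianStructure C).category
    letI := (cartesianStructure C).cartesian
    letI := (cartesianStructure D).category
    letI := (cartesianStructure D).cartesian
    StrictCartFunctor (Obj C) (Obj D) :=
  letI := (cartesianStructure C).category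
  letI := (cartesianStructure C).cartesian
  letI := (cartesianStructure D).category
  letI := (cartesianStructure D).cartesian
  { obj := mapObj F
    map := mapHom F
    map_id P := by
      refine (mapHom_ofLinear F (𝟙 P.base) (𝟙 P.vec)).trans (Hom.ext' (F.map_id _) fun n => ?_)
      exact congrArg (fun k => linear _ _ k n) (F.map_id P.vec)
    map_comp f g := mapHom_comp F f g
    obj_unit := mapObj_unit F
    obj_prod := mapObj_prod F
    map_fst P Q :=
      (congrArg Arrow.mk (mapHom_ofLinear F (P := prod P Q) (Q := P) (fst P.base Q.base)
        (fst P.vec Q.vec))).trans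
      (arrow_ofLinear (P := mapObj F (prod P Q)) (Q := mapObj F P)
        (P' := prod (mapObj F P) (mapObj F Q)) (Q' := mapObj F P) _ (mapObj_prod F P Q) rfl _ _
        (h := isAddMonHom_map F (P := prod P Q) (Q := P) (fst P.vec Q.vec))
        (h' := Hom.isAddMonHom_fst (mapObj F P) (mapObj F Q)) (F.map_fst _ _) (F.map_fst _ _))
    map_snd P Q :=
      (congrArg Arrow.mk (mapHom_ofLinear F (P := prod P Q) (Q := Q) (snd P.base Q.base)
        (snd P.vec Q.vec))).trans
      (arrow_ofLinear (P := mapObj F (prod P Q)) (Q := mapObj F Q)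
        (P' := prod (mapObj F P) (mapObj F Q)) (Q' := mapObj F Q) _ (mapObj_prod F P Q) rfl _ _
        (h := isAddMonHom_map F (P := prod P Q) (Q := Q) (snd P.vec Q.vec))
        (h' := Hom.isAddMonHom_snd (mapObj F P) (mapObj F Q)) (F.map_snd _ _) (F.map_snd _ _)) }

theorem isAction_mapFunctor (F : StrictCartFunctor C D) :
    IsAction F.toFunctor (mapObj F) (fun _ _ f => mapHom F f) where
  vec _ := rfl
  add := arrow_mapObj_add F
  zero := arrow_mapObj_zero F
  base _ := rfl
  map_star _ _ _ := rfl
  map_map _ _ _ _ := Arrow.arrow_mk_eqToHom_comp _ _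

/-- The arrow of Cartesian categories induced by an arrow of Cartesian categories. -/
def mapCartCat {X Y : CartCat.{v, max u v}} (F : X ⟶ Y) :
    (cartesianStructure X).toCartCat ⟶ (cartesianStructure Y).toCartCat := mapFunctor F

theorem mapCartCat_id (X : CartCat.{v, max u v}) :
    mapCartCat (𝟙 X) = 𝟙 (cartesianStructure X).toCartCat :=
  StrictCartFunctor.ext_arrow (C := (cartesianStructure X).toCartCat)
    (D := (cartesianStructure X).toCartCat) fun {P Q} _ =>
    arrow_ext (cartesianStructure X) (mapObj_id X P) (mapObj_id X Q) rfl
      fun _ => Arrow.arrow_mk_eqToHom_comp _ _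

theorem mapCartCat_comp {X Y Z : CartCat.{v, max u v}} (F : X ⟶ Y) (G : Y ⟶ Z) :
    mapCartCat (F ≫ G) = mapCartCat F ≫ mapCartCat G :=
  StrictCartFunctor.ext_arrow (C := (cartesianStructure X).toCartCat)
    (D := (cartesianStructure Z).toCartCat) fun {P Q} f =>
    arrow_ext (cartesianStructure Z) (mapObj_comp F G P) (mapObj_comp F G Q) rfl fun n =>
      (Arrow.arrow_mk_eqToHom_comp _ _).trans ((Arrow.arrow_mk_eqToHom_comp _ _).trans
        (congrArg G.toFunctor.mapArrow.obj (Arrow.arrow_mk_eqToHom_comp (F.map (f.map n))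
          (pow_eq F P.vec P.base n)))).symm

/-- The Faà di Bruno functor. -/
def functor : CartCat.{v, max u v} ⥤ CartCat.{v, max u v} where
  obj X := (cartesianStructure X).toCartCat
  map := mapCartCat
  map_id := mapCartCat_id
  map_comp := mapCartCat_comp

end

end Faa

theorem mainTheorem3 :
    ∃ (S : ∀ X : CartCat.{v, max u v}, Faa.CartesianStructure X)
      (Φ : CartCat.{v, max u v} ⥤ CartCat.{v, max u v})
      (hΦ : ∀ X : CartCat.{v, max u v}, Φ.obj X = (S X).toCartCat),
      ∀ (X Y : CartCat.{v, max u v}) (F : X ⟶ Y),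
        ∃ G : StrictCartFunctor (S X).toCartCat (S Y).toCartCat,
          Φ.map F = eqToHom (hΦ X) ≫ G ≫ eqToHom (hΦ Y).symm ∧
          Faa.IsAction F.toFunctor G.obj (fun _ _ f => G.map f) := by
  refine ⟨fun X => Faa.cartesianStructure X, Faa.functor, fun X => rfl, fun X Y F =>
    ⟨Faa.mapFunctor F, ?_, Faa.isAction_mapFunctor F⟩⟩
  exact ((Category.id_comp _).trans (Category.comp_id _)).symm
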